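/- Let $(\Omega,\mathcal F,(\mathcal F_t)_{t\in[0,T]},\mathsf P)$ be a filtered probability space such that $\mathcal F_0$ is $\mathsf P$-trivial and $(\mathcal F_t)$ is right-continuous. Let $\mathcal P$ be the set of probability measures on $\mathcal F$ that are absolutely continuous with respect to $\mathsf P$; measures $\mathsf Q\in\mathcal P$ are identified with their densities $d\mathsf Q/d\mathsf P\in L^1(\mathsf P)$. For a random variable $X$ and $\mathsf Q\in\mathcal P$ put $\mathsf E_{\mathsf Q}X=\mathsf E_{\mathsf Q}X^+-\mathsf E_{\mathsf Q}X^-\in[-\infty,\infty]$ with the convention $\infty-\infty=-\infty$. Let $\mathcal D\subseteq\mathcal P$ be convex and compact in the weak topology of $L^1(\mathsf P)$, and let $$L^1_s(\mathcal D)=\Bigl\{X\in L^0:\lim_{n\to\infty}\sup_{\mathsf Q\in\mathcal D}\mathsf E_{\mathsf Q}|X|I(|X|>n)=0\Bigr\}.$$ Let $I$ be an arbitrary set, and let $S^{ai},S^{bi}$, $i\in I$ (the ask and bid price processes), be $(\mathcal F_t)$-adapted càdlàg real-valued processes with $S^{ai}\ge S^{bi}$ and $S^{ai}_t,S^{bi}_t\in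 L^1_s(\mathcal D)$ for all $t\in[0,T]$, $i\in I$. Stopping times take values in $[0,T]$, and a stopping time is called simple if it takes a finite number of values. Put $$A=\Bigl\{\sum_{n=0}^N\sum_{i\in I}\bigl[-H_n^iI(H_n^i>0)S^{ai}_{u_n}-H_n^iI(H_n^i<0)S^{bi}_{u_n}\bigr]\Bigr\},$$ where $N\in\mathbb N$, $u_0\le\dots\le u_N$ are $(\mathcal F_t)$-stopping times, each $H_n^i$ is a real-valued $\mathcal F_{u_n}$-measurable random variable, $H_n^i=0$ for all $i$ outside a (nonrandom) finite set, and $\sum_{n=0}^NH_n^i=0$ for every $i$. Put also $$A'=\bigl\{G(S^{bi}_v-S^{ai}_u)+H(-S^{ai}_v+S^{bi}_u)\bigr\},$$ where $i\in I$, $u\le v$ are simple $(\mathcal F_t)$-stopping times, and $G,H$ are nonnegative bounded $\mathcal F_u$-measurable random variables. For a set $B$ of random variables let $$\mathcal R(B)=\{\mathsf Q\in\mathcal P:\mathsf E_{\mathsf Q}X\le0\text{ for all }X\in B\},\qquad\mathcal R=\mathcal R(A),$$ and let $\mathcal M$ be the set of all $\mathsf Q\in\mathcal P$ such that for every $i\in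 I$ there is an $(\mathcal F_t,\mathsf Q)$-martingale $M^i$ with, $\mathsf Q$-almost surely, $S^{bi}_t\le M^i_t\le S^{ai}_t$ for all $t\in[0,T]$. Then $$\mathcal D\cap\mathcal R=\mathcal D\cap\mathcal R(A')=\mathcal D\cap\mathcal M.$$ -/

import Mathlib

open MeasureTheory Filter Topology
open scoped ENNReal

namespace BidAsk

noncomputable section

/-- The expectation `E_Q X = E_Q X⁺ - E_Q X⁻ ∈ [-∞, ∞]`, with the convention `∞ - ∞ = -∞`
(this is the convention of subtraction in `EReal`). -/
def expect {Ω : Type*} [MeasurableSpace Ω] (Q : Measure Ω) (X : Ω → ℝ) : EReal :=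
  ((∫⁻ ω, ENNReal.ofReal (X ω) ∂Q : ℝ≥0∞) : EReal) -
    ((∫⁻ ω, ENNReal.ofReal (-X ω) ∂Q : ℝ≥0∞) : EReal)

/-- The set `𝒫` of probability measures that are absolutely continuous with respect to `P`. -/
def acProb {Ω : Type*} [MeasurableSpace Ω] (P : Measure Ω) : Set (Measure Ω) :=
  {Q | IsProbabilityMeasure Q ∧ Q ≪ P}

/-- The set of densities `dQ/dP`, `Q ∈ 𝒟`, as a subset of `L¹(P)`. -/
def densities {Ω : Type*} [MeasurableSpace Ω] (P : Measure Ω) (𝒟 : Set (Measure Ω)) :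
    Set (Lp ℝ 1 P) :=
  {Z | ∃ Q ∈ 𝒟, Z =ᵐ[P] fun ω => (Q.rnDeriv P ω).toReal}

/-- `𝒟 ⊆ 𝒫` is convex and weakly compact: measures are identified with their densities, and
weak compactness refers to the weak topology of the Banach space `L¹(P)`. -/
structure IsConvexWeaklyCompact {Ω : Type*} [MeasurableSpace Ω] (P : Measure Ω)
    (𝒟 : Set (Measure Ω)) : Prop where
  subset : 𝒟 ⊆ acProb P
  convex : Convex ℝ (densities P 𝒟)
  weaklyCompact : IsCompact (toWeakSpace ℝ (Lp ℝ 1 P) '' densities P 𝒟)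

/-- The strong `L¹`-space of `𝒟`: random variables `X` such that
`sup_{Q ∈ 𝒟} E_Q |X| I(|X| > n) → 0` as `n → ∞`. -/
def StrongL1 {Ω : Type*} [MeasurableSpace Ω] (P : Measure Ω) (𝒟 : Set (Measure Ω)) :
    Set (Ω → ℝ) :=
  {X | AEMeasurable X P ∧
    Tendsto (fun n : ℕ => ⨆ Q ∈ 𝒟, ∫⁻ ω in {ω | (n : ℝ) < |X ω|}, ENNReal.ofReal |X ω| ∂Q)
      atTop (𝓝 0)}

/-- The set `ℛ(A)` of risk-neutral measures for a set `A` of P&Ls. -/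
def riskNeutral {Ω : Type*} [MeasurableSpace Ω] (P : Measure Ω) (A : Set (Ω → ℝ)) :
    Set (Measure Ω) :=
  {Q | Q ∈ acProb P ∧ ∀ X ∈ A, expect Q X ≤ 0}

/-- All paths are right-continuous on `[0, T]` and have finite left limits. -/
def IsCadlag {Ω : Type*} {T : ℝ} (S : Set.Icc (0 : ℝ) T → Ω → ℝ) : Prop :=
  ∀ ω t, ContinuousWithinAt (fun s => S s ω) (Set.Ici t) t ∧
    ∃ l : ℝ, Tendsto (fun s => S s ω) (𝓝[<] t) (𝓝 l)

/-- `τ : Ω → [0, T]` is a stopping time. -/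
abbrev IsStop {Ω : Type*} [m : MeasurableSpace Ω] {T : ℝ} (𝓕 : Filtration (Set.Icc (0 : ℝ) T) m)
    (τ : Ω → Set.Icc (0 : ℝ) T) : Prop :=
  IsStoppingTime 𝓕 (fun ω => (τ ω : WithTop (Set.Icc (0 : ℝ) T)))

/-- The cash flow from buying `h` units of an asset (selling `-h` units if `h < 0`) when the ask
price is `a` and the bid price is `b`: `-h I(h > 0) a - h I(h < 0) b`. -/
def cashFlow (h a b : ℝ) : ℝ :=
  -h * (if 0 < h then 1 else 0) * a - h * (if h < 0 then 1 else 0) * b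

/-- The set `A` of attainable P&Ls: at the stopping time `u n`, the amount `H n i` of the asset `i`
is bought; only the assets in the finite set `J` are traded, and all positions are closed at the
end. -/
def attainable {Ω I : Type*} [m : MeasurableSpace Ω] {T : ℝ}
    (𝓕 : Filtration (Set.Icc (0 : ℝ) T) m) (Sa Sb : I → Set.Icc (0 : ℝ) T → Ω → ℝ) :
    Set (Ω → ℝ) :=
  {X | ∃ (N : ℕ) (u : Fin (N + 1) → Ω → Set.Icc (0 : ℝ) T) (hu : ∀ n, IsStop 𝓕 (u n))
      (H : Fin (N + 1) → I → Ω → ℝ) (J : Finset I),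
    Monotone u ∧
    (∀ n i, Measurable[(hu n).measurableSpace] (H n i)) ∧
    (∀ n, ∀ i ∉ J, H n i = 0) ∧
    (∀ i, ∑ n, H n i = 0) ∧
    X = fun ω => ∑ n, ∑ i ∈ J, cashFlow (H n i ω) (Sa i (u n ω) ω) (Sb i (u n ω) ω)}

/-- The set `A'` of P&Ls of simple round-trip trades
`G (S^b_v - S^a_u) + H (-S^a_v + S^b_u)`, where `u ≤ v` are simple stopping times and `G`, `H` are
nonnegative, bounded and `𝓕_u`-measurable. -/
def simpleTrades {Ω I : Type*} [m : MeasurableSpace Ω] {T : ℝ}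
    (𝓕 : Filtration (Set.Icc (0 : ℝ) T) m) (Sa Sb : I → Set.Icc (0 : ℝ) T → Ω → ℝ) :
    Set (Ω → ℝ) :=
  {X | ∃ (i : I) (u v : Ω → Set.Icc (0 : ℝ) T) (hu : IsStop 𝓕 u) (_ : IsStop 𝓕 v)
      (G H : Ω → ℝ),
    (Set.range u).Finite ∧ (Set.range v).Finite ∧ u ≤ v ∧
    Measurable[hu.measurableSpace] G ∧ Measurable[hu.measurableSpace] H ∧
    (∃ C, ∀ ω, 0 ≤ G ω ∧ G ω ≤ C) ∧ (∃ C, ∀ ω, 0 ≤ H ω ∧ H ω ≤ C) ∧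
    X = fun ω => G ω * (Sb i (v ω) ω - Sa i (u ω) ω) + H ω * (-Sa i (v ω) ω + Sb i (u ω) ω)}

/-- The set `ℳ` of the measures `Q ∈ 𝒫` such that, for every asset `i`, there is an
`(𝓕_t, Q)`-martingale whose paths lie `Q`-a.s. between the bid and the ask price processes. -/
def martingaleMeasures {Ω I : Type*} [m : MeasurableSpace Ω] (P : Measure Ω) {T : ℝ}
    (𝓕 : Filtration (Set.Icc (0 : ℝ) T) m) (Sa Sb : I → Set.Icc (0 : ℝ) T → Ω → ℝ) :
    Set (Measure Ω) :=
  {Q | Q ∈ acProb P ∧ ∀ i, ∃ M : Set.Icc (0 : ℝ) T → Ω → ℝ,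
    Martingale M 𝓕 Q ∧ ∀ᵐ ω ∂Q, ∀ t, Sb i t ω ≤ M t ω ∧ M t ω ≤ Sa i t ω}

end

end BidAsk

/-! The three sets are compared in a cycle. The easy link is that a round trip is an attainable
strategy.

From a martingale between bid and ask to nonpositive expectations: trading at bid and ask is never
better than trading at a price between them (`cashFlow_le`), so an attainable P&L is dominated by a
discrete martingale transform. Positions are unbounded, so the transform is only a generalized
martingale, but its final value has nonpositive mean once its negative part is integrable
(`lintegral_transform_le`); otherwise the convention `∞ - ∞ = -∞` applies.

From simple trades to a martingale: testing with indicators of sets in `𝓕 t` gives `E[Sb_v|𝓕_t] ≤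
Sa_t` and `Sb_t ≤ E[Sa_v|𝓕_t]` for simple `v ≥ t`. On a finite grid the upper Snell envelope of the
bid then lies below the lower Snell envelope of the ask, and a martingale can be steered between
them (`exists_martingale_between_grid`). Its terminal value `Z` lies between the terminal bid `a`
and ask `b`, so `Z = a + s q` with `s = √(b - a)` in L² and `|q| ≤ s`. The grid constraints are
linear in `q`, and a Hilbert space argument (`exists_forall_inner_le`) gives one `Z` for all dyadic
grids. Right-continuity of paths and filtration carries the bounds from dyadic times to all times
(`stopped_le_condExp`). -/

namespace BidAsk

/-! ### Nested linear constraints in a Hilbert space -/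

/-- In a Hilbert space, an increasing sequence of systems of linear inequalities has a common
solution as soon as each system has a solution in a fixed ball. -/
lemma exists_forall_inner_le {E : Type*} [NormedAddCommGroup E] [InnerProductSpace ℝ E]
    [CompleteSpace E] (C : ℕ → Set (E × ℝ)) (hC : Monotone C) (R : ℝ)
    (h : ∀ n, ∃ g : E, ‖g‖ ≤ R ∧ ∀ p ∈ C n, inner ℝ p.1 g ≤ p.2) :
    ∃ g : E, ∀ n, ∀ p ∈ C n, inner ℝ p.1 g ≤ p.2 := by
  set K : ℕ → Set E := fun n => {g | ∀ p ∈ C n, inner ℝ p.1 g ≤ p.2} with hK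
  have hKconv : ∀ n, Convex ℝ (K n) := by
    intro n x hx y hy a b ha hb hab p hp
    rw [inner_add_right, inner_smul_right, inner_smul_right]
    calc a * inner ℝ p.1 x + b * inner ℝ p.1 y ≤ a * p.2 + b * p.2 := by
          gcongr
          · exact hx p hp
          · exact hy p hp
      _ = p.2 := by rw [← add_mul, hab, one_mul]
  have hKclosed : ∀ n, IsClosed (K n) := by
    intro n
    have : K n = ⋂ p ∈ C n, {g | inner ℝ p.1 g ≤ p.2} := by ext; simp [hK]
    rw [this]
    exact isClosed_biInter fun p _ => isClosed_le (by fun_prop) continuous_const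
  have hKanti : ∀ {n k}, n ≤ k → K k ⊆ K n := fun hnk g hg p hp => hg p (hC hnk hp)
  -- The solution `x n` of least norm is used: these norms increase and stay below `R`, and since
  -- midpoints of `x n` and `x k` lie in `K n`, the parallelogram law makes `x` Cauchy.
  have hmin : ∀ n, ∃ g ∈ K n, ∀ w ∈ K n, ‖g‖ ≤ ‖w‖ := by
    intro n
    obtain ⟨g₀, -, hg₀⟩ := h n
    obtain ⟨g, hg, hgmin⟩ := exists_norm_eq_iInf_of_complete_convex (K := K n) ⟨g₀, hg₀⟩
      (hKclosed n).isComplete (hKconv n) 0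
    refine ⟨g, hg, fun w hw => ?_⟩
    have : ‖(0 : E) - g‖ ≤ ‖(0 : E) - w‖ := by
      rw [hgmin]
      exact ciInf_le (f := fun w : K n => ‖(0 : E) - w‖)
        ⟨0, by rintro _ ⟨w, rfl⟩; exact norm_nonneg _⟩ ⟨w, hw⟩
    simpa using this
  choose x hxK hxmin using hmin
  have hxmono : Monotone fun n => ‖x n‖ ^ 2 := fun n k hnk => by
    have := hxmin n _ (hKanti hnk (hxK k))
    simp only
    gcongr
  have hbdd : BddAbove (Set.range fun n => ‖x n‖ ^ 2) := by
    refine ⟨R ^ 2, ?_⟩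
    rintro _ ⟨n, rfl⟩
    obtain ⟨g, hgR, hg⟩ := h n
    have := (hxmin n g hg).trans hgR
    simp only
    gcongr
  have hconv := tendsto_atTop_ciSup hxmono hbdd
  have hdist : ∀ {n k}, n ≤ k → ‖x n - x k‖ ^ 2 ≤ 2 * (‖x k‖ ^ 2 - ‖x n‖ ^ 2) := by
    intro n k hnk
    have hmid : (1 / 2 : ℝ) • x n + (1 / 2 : ℝ) • x k ∈ K n :=
      hKconv n (hxK n) (hKanti hnk (hxK k)) (by norm_num) (by norm_num) (by norm_num)
    have h1 := hxmin n _ hmid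
    rw [← smul_add, norm_smul] at h1
    norm_num at h1
    have h2 := parallelogram_law_with_norm ℝ (x n) (x k)
    nlinarith [norm_nonneg (x n), norm_nonneg (x n + x k)]
  have hcau : CauchySeq x := by
    refine Metric.cauchySeq_iff'.2 fun ε hε => ?_
    obtain ⟨N, hN⟩ := Metric.cauchySeq_iff'.1 hconv.cauchySeq (ε ^ 2 / 2) (by positivity)
    refine ⟨N, fun n hn => ?_⟩
    have h1 := hdist hn
    have h2 := hN n hn
    rw [Real.dist_eq, abs_of_nonneg (sub_nonneg.2 (hxmono hn))] at h2
    rw [dist_comm, dist_eq_norm]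
    refine lt_of_pow_lt_pow_left₀ 2 hε.le ?_
    simp only at h2
    linarith
  obtain ⟨g, hg⟩ := cauchySeq_tendsto_of_complete hcau
  refine ⟨g, fun n => ?_⟩
  exact (hKclosed n).mem_of_tendsto hg
    (eventually_atTop.2 ⟨n, fun k hk => hKanti hk (hxK k)⟩)

/-! ### Expectations in the extended reals -/

section Expect

variable {Ω : Type*} [m : MeasurableSpace Ω] {Q : Measure Ω}

lemma expect_eq_integral {X : Ω → ℝ} (hX : Integrable X Q) :
    expect Q X = ((∫ ω, X ω ∂Q : ℝ) : EReal) := by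
  rw [expect, integral_eq_lintegral_pos_part_sub_lintegral_neg_part hX, EReal.coe_sub,
    EReal.coe_ennreal_toReal, EReal.coe_ennreal_toReal]
  · exact hX.neg.lintegral_lt_top.ne
  · exact hX.lintegral_lt_top.ne

/-- If the negative part of `X` has infinite integral, the convention gives `-∞`. Otherwise the
smaller negative part of `Y` is integrable too, and the inequality assumed for `Y` passes to `X`. -/
lemma expect_nonpos_of_ae_le {X Y : Ω → ℝ} (hXY : X ≤ᵐ[Q] Y)
    (hY : ∫⁻ ω, ENNReal.ofReal (-Y ω) ∂Q ≠ ∞ →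
      ∫⁻ ω, ENNReal.ofReal (Y ω) ∂Q ≤ ∫⁻ ω, ENNReal.ofReal (-Y ω) ∂Q) :
    expect Q X ≤ 0 := by
  have h1 : ∫⁻ ω, ENNReal.ofReal (X ω) ∂Q ≤ ∫⁻ ω, ENNReal.ofReal (Y ω) ∂Q :=
    lintegral_mono_ae (hXY.mono fun ω h => ENNReal.ofReal_le_ofReal h)
  have h2 : ∫⁻ ω, ENNReal.ofReal (-Y ω) ∂Q ≤ ∫⁻ ω, ENNReal.ofReal (-X ω) ∂Q :=
    lintegral_mono_ae (hXY.mono fun ω h => ENNReal.ofReal_le_ofReal (neg_le_neg h))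
  rw [expect]
  by_cases htop : ∫⁻ ω, ENNReal.ofReal (-X ω) ∂Q = ∞
  · rw [htop, EReal.coe_ennreal_top, EReal.sub_top]
    exact bot_le
  · have h3 := (h1.trans (hY (ne_top_of_le_ne_top htop h2))).trans h2
    rw [EReal.sub_nonpos]
    exact_mod_cast h3

end Expect

/-! ### Generalized martingale transforms in discrete time -/

section Transform

variable {Ω ι : Type*} {m0 : MeasurableSpace Ω} {Q : Measure Ω} [IsFiniteMeasure Q]

lemma integral_indicator_mul_eq_zero {G : MeasurableSpace Ω} (hG : G ≤ m0) {θ D : Ω → ℝ}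
    {C : Set Ω} {k : ℝ} (hC : MeasurableSet[G] C) (hθ : Measurable[G] θ)
    (hθk : ∀ ω ∈ C, |θ ω| ≤ k) (hD : Integrable D Q) (hD0 : Q[D|G] =ᵐ[Q] 0) :
    IntegrableOn (fun ω => θ ω * D ω) C Q ∧ ∫ ω in C, θ ω * D ω ∂Q = 0 := by
  have hθC : StronglyMeasurable[G] (C.indicator θ) := (hθ.indicator hC).stronglyMeasurable
  have hint : Integrable (C.indicator θ * D) Q := by
    refine hD.bdd_mul (c := max k 0) (hθC.mono hG).aestronglyMeasurable (ae_of_all _ fun ω => ?_)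
    by_cases hω : ω ∈ C
    · simp [hω, hθk ω hω]
    · simp [hω]
  have heq : C.indicator (fun ω => θ ω * D ω) = C.indicator θ * D := by
    ext ω
    by_cases hω : ω ∈ C <;> simp [hω]
  have hpull := condExp_mul_of_stronglyMeasurable_left (μ := Q) hθC hint hD
  refine ⟨(integrable_indicator_iff (hG _ hC)).1 (heq ▸ hint), ?_⟩
  rw [← integral_indicator (hG _ hC), heq, ← integral_condExp hG]
  rw [integral_congr_ae (g := 0)]
  · simp
  · filter_upwards [hpull, hD0] with ω h1 h2
    rw [h1, Pi.mul_apply, h2]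
    simp

/-- A generalized martingale increment balances positive and negative parts on every set of the
past, without any integrability. -/
lemma lintegral_posPart_add_eq {G : MeasurableSpace Ω} (hG : G ≤ m0) (J : Finset ι)
    {L : Ω → ℝ} {θ D : ι → Ω → ℝ} (hL : Measurable[G] L) (hθ : ∀ i, Measurable[G] (θ i))
    (hD : ∀ i, Integrable (D i) Q) (hD0 : ∀ i, Q[D i|G] =ᵐ[Q] 0)
    {C : Set Ω} (hC : MeasurableSet[G] C) :
    ∫⁻ ω in C, ENNReal.ofReal (L ω + ∑ i ∈ J, θ i ω * D i ω) ∂Q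
        + ∫⁻ ω in C, ENNReal.ofReal (-L ω) ∂Q =
      ∫⁻ ω in C, ENNReal.ofReal (-(L ω + ∑ i ∈ J, θ i ω * D i ω)) ∂Q
        + ∫⁻ ω in C, ENNReal.ofReal (L ω) ∂Q := by
  -- Localization: on `B k` the value `L` and the positions `θ` are bounded by `k`, so ordinary
  -- integration applies; monotone convergence then restores `C`. The identity is stated additively
  -- because all four terms may be infinite.
  set B : ℕ → Set Ω := fun k => C ∩ {ω | |L ω| ≤ k ∧ ∀ i ∈ J, |θ i ω| ≤ k} with hB
  have hBmeas : ∀ k, MeasurableSet[G] (B k) := by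
    intro k
    refine hC.inter (MeasurableSet.inter (m := G) ?_ ?_)
    · exact hL.abs measurableSet_Iic
    · have : {ω | ∀ i ∈ J, |θ i ω| ≤ (k : ℝ)} = ⋂ i ∈ J, {ω | |θ i ω| ≤ (k : ℝ)} := by
        ext; simp
      change MeasurableSet[G] {ω | ∀ i ∈ J, |θ i ω| ≤ (k : ℝ)}
      rw [this]
      exact Finset.measurableSet_biInter J fun i _ =>
        (hθ i).abs measurableSet_Iic
  have hBmono : Monotone B := by
    intro k l hkl ω hω
    have : (k : ℝ) ≤ l := by exact_mod_cast hkl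
    exact ⟨hω.1, hω.2.1.trans this, fun i hi => (hω.2.2 i hi).trans this⟩
  have hBunion : ⋃ k, B k = C := by
    ext ω
    simp only [Set.mem_iUnion]
    refine ⟨fun ⟨k, hk⟩ => hk.1, fun hω => ?_⟩
    obtain ⟨k, hk⟩ := exists_nat_ge (|L ω| + ∑ i ∈ J, |θ i ω|)
    have hnn : 0 ≤ ∑ i ∈ J, |θ i ω| := Finset.sum_nonneg fun i _ => abs_nonneg _
    refine ⟨k, hω, by linarith, fun i hi => ?_⟩
    have := Finset.single_le_sum (f := fun i => |θ i ω|) (fun i _ => abs_nonneg _) hi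
    linarith [abs_nonneg (L ω)]
  have key : ∀ k, ∫⁻ ω in B k, ENNReal.ofReal (L ω + ∑ i ∈ J, θ i ω * D i ω) ∂Q
        + ∫⁻ ω in B k, ENNReal.ofReal (-L ω) ∂Q =
      ∫⁻ ω in B k, ENNReal.ofReal (-(L ω + ∑ i ∈ J, θ i ω * D i ω)) ∂Q
        + ∫⁻ ω in B k, ENNReal.ofReal (L ω) ∂Q := by
    intro k
    have hLint : IntegrableOn L (B k) Q := by
      refine Integrable.of_bound (hL.mono hG le_rfl).aestronglyMeasurable k ?_
      exact (ae_restrict_iff' (hG _ (hBmeas k))).2 (ae_of_all _ fun ω hω => hω.2.1)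
    have hterm := fun i (hi : i ∈ J) => integral_indicator_mul_eq_zero hG (hBmeas k) (hθ i)
      (k := k) (fun ω hω => hω.2.2 i hi) (hD i) (hD0 i)
    have hsum : IntegrableOn (fun ω => ∑ i ∈ J, θ i ω * D i ω) (B k) Q :=
      integrable_finsetSum J fun i hi => (hterm i hi).1
    have hsum0 : ∫ ω in B k, ∑ i ∈ J, θ i ω * D i ω ∂Q = 0 := by
      rw [integral_finsetSum J fun i hi => (hterm i hi).1]
      exact Finset.sum_eq_zero fun i hi => (hterm i hi).2
    have hint : ∫ ω in B k, (L ω + ∑ i ∈ J, θ i ω * D i ω) ∂Q = ∫ ω in B k, L ω ∂Q := by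
      rw [integral_add hLint hsum, hsum0, add_zero]
    have hadd : IntegrableOn (fun ω => L ω + ∑ i ∈ J, θ i ω * D i ω) (B k) Q := hLint.add hsum
    rw [integral_eq_lintegral_pos_part_sub_lintegral_neg_part hadd,
      integral_eq_lintegral_pos_part_sub_lintegral_neg_part hLint] at hint
    have f1 := hadd.lintegral_lt_top.ne
    have f2 := hadd.neg.lintegral_lt_top.ne
    have f3 := hLint.lintegral_lt_top.ne
    have f4 := hLint.neg.lintegral_lt_top.ne
    simp only [Pi.neg_apply] at f1 f2 f3 f4 hint
    rw [← ENNReal.toReal_eq_toReal_iff' (ENNReal.add_ne_top.2 ⟨f1, f4⟩)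
      (ENNReal.add_ne_top.2 ⟨f2, f3⟩), ENNReal.toReal_add f1 f4, ENNReal.toReal_add f2 f3]
    linarith
  have hdir := hBmono.directed_le
  have hmono : ∀ f : Ω → ℝ≥0∞, Monotone fun k => ∫⁻ ω in B k, f ω ∂Q :=
    fun f k l hkl => lintegral_mono_set (hBmono hkl)
  rw [← hBunion]
  simp_rw [setLIntegral_iUnion_of_directed _ hdir]
  rw [ENNReal.iSup_add_iSup_of_monotone (hmono _) (hmono _),
    ENNReal.iSup_add_iSup_of_monotone (hmono _) (hmono _)]
  exact iSup_congr key

/-- A discrete-time generalized martingale started at `0` has nonpositive expectation at every time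
at which its negative part is integrable. -/
lemma lintegral_transform_le (G : ℕ → MeasurableSpace Ω) (hG : ∀ n, G n ≤ m0) (J : Finset ι)
    (L : ℕ → Ω → ℝ) (θ D : ℕ → ι → Ω → ℝ) (hL : ∀ n, Measurable[G n] (L n))
    (hθ : ∀ n i, Measurable[G n] (θ n i)) (hD : ∀ n i, Integrable (D n i) Q)
    (hD0 : ∀ n i, Q[D n i|G n] =ᵐ[Q] 0) (hL0 : L 0 = 0)
    (hstep : ∀ n ω, L (n + 1) ω = L n ω + ∑ i ∈ J, θ n i ω * D n i ω) (n : ℕ)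
    (hn : ∫⁻ ω, ENNReal.ofReal (-L n ω) ∂Q ≠ ∞) :
    ∫⁻ ω, ENNReal.ofReal (L n ω) ∂Q ≤ ∫⁻ ω, ENNReal.ofReal (-L n ω) ∂Q := by
  induction n with
  | zero => simp [hL0]
  | succ n ih =>
    have key := fun C hC => lintegral_posPart_add_eq (hG n) J (hL n) (hθ n) (hD n) (hD0 n)
      (C := C) hC
    simp_rw [← hstep] at key
    -- On the past event `L n < 0` the balance has no positive part of `L n`, so negative parts grow
    -- with `n`, and finiteness at the last time descends to all earlier ones.
    have hneg : ∫⁻ ω, ENNReal.ofReal (-L n ω) ∂Q ≤ ∫⁻ ω, ENNReal.ofReal (-L (n + 1) ω) ∂Q := by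
      have hC : MeasurableSet[G n] {ω | L n ω < 0} :=
        hL n measurableSet_Iio
      have h1 := key _ hC
      have h2 : ∫⁻ ω in {ω | L n ω < 0}, ENNReal.ofReal (L n ω) ∂Q = 0 := by
        rw [setLIntegral_congr_fun (g := 0) (hG n _ hC)
          fun ω hω => ENNReal.ofReal_of_nonpos (le_of_lt hω)]
        simp
      have h3 : ∫⁻ ω in {ω | L n ω < 0}, ENNReal.ofReal (-L n ω) ∂Q
          = ∫⁻ ω, ENNReal.ofReal (-L n ω) ∂Q := by
        rw [← lintegral_indicator (hG n _ hC)]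
        refine lintegral_congr fun ω => ?_
        by_cases hω : L n ω < 0
        · simp [hω]
        · simp [hω, not_lt.1 hω]
      rw [h2, add_zero, h3] at h1
      calc ∫⁻ ω, ENNReal.ofReal (-L n ω) ∂Q
          ≤ _ + ∫⁻ ω, ENNReal.ofReal (-L n ω) ∂Q := le_add_self
        _ = _ := h1
        _ ≤ _ := setLIntegral_le_lintegral _ _
    have hfin := ne_top_of_le_ne_top hn hneg
    have h := key _ (@MeasurableSet.univ _ (G n))
    simp only [Measure.restrict_univ] at h
    refine (ENNReal.add_le_add_iff_right hfin).1 (h.trans_le ?_)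
    exact add_le_add le_rfl (ih hfin)

end Transform

/-! ### Dyadic approximation of stopping times from the right -/

section DyadicGrid

variable {T : ℝ} (hT : 0 ≤ T)

/-- The `k`-th point of the dyadic grid of level `m` in `[0, T]`. -/
noncomputable def gridTime (m k : ℕ) : Set.Icc (0 : ℝ) T :=
  -- Indices beyond `2 ^ m` are clamped to the endpoint `T`, which gives a monotone sequence on all
  -- of `ℕ`.
  ⟨T * (min k (2 ^ m) : ℕ) / 2 ^ m, by
    refine ⟨by positivity, ?_⟩
    rw [div_le_iff₀ (by positivity)]
    refine mul_le_mul_of_nonneg_left ?_ hT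
    exact_mod_cast min_le_right k (2 ^ m)⟩

/-- The smallest point of the dyadic grid of level `m` that is not before `x`. -/
noncomputable def gridCeil (m : ℕ) (x : Set.Icc (0 : ℝ) T) : Set.Icc (0 : ℝ) T :=
  gridTime hT m ⌈2 ^ m * (x : ℝ) / T⌉₊

lemma gridTime_mono (m : ℕ) : Monotone (gridTime hT m) := by
  intro k l hkl
  rw [← Subtype.coe_le_coe]
  simp only [gridTime]
  have : (min k (2 ^ m) : ℕ) ≤ min l (2 ^ m) := min_le_min_right _ hkl
  gcongr

lemma gridTime_succ (m k : ℕ) : gridTime hT (m + 1) (2 * k) = gridTime hT m k := by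
  ext
  simp only [gridTime]
  have : min (2 * k) (2 ^ (m + 1)) = 2 * min k (2 ^ m) := by
    rw [pow_succ', Nat.mul_min_mul_left]
  rw [this, pow_succ']
  push_cast
  field_simp

lemma gridTime_last (m : ℕ) : gridTime hT m (2 ^ m) = ⟨T, hT, le_rfl⟩ := by
  ext
  simp [gridTime]

lemma gridTime_min (m k : ℕ) : gridTime hT m (min k (2 ^ m)) = gridTime hT m k := by
  ext
  simp [gridTime]

lemma le_gridCeil (m : ℕ) (x : Set.Icc (0 : ℝ) T) : x ≤ gridCeil hT m x := by
  rw [← Subtype.coe_le_coe]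
  -- For `T = 0` the quotient in `gridCeil` is a division by zero, but the interval is a single
  -- point.
  rcases hT.eq_or_lt with h0 | hpos
  · exact x.2.2.trans (h0.symm.le.trans (gridCeil hT m x).2.1)
  simp only [gridCeil, gridTime]
  have h1 : ⌈2 ^ m * (x : ℝ) / T⌉₊ ≤ 2 ^ m := by
    rw [Nat.ceil_le, div_le_iff₀ hpos]
    push_cast
    exact mul_le_mul_of_nonneg_left x.2.2 (by positivity)
  rw [min_eq_left h1, le_div_iff₀ (by positivity)]
  have h2 := Nat.le_ceil (2 ^ m * (x : ℝ) / T)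
  rw [div_le_iff₀ hpos] at h2
  linarith

lemma gridCeil_le (m k : ℕ) {x : Set.Icc (0 : ℝ) T} (hx : x ≤ gridTime hT m k) :
    gridCeil hT m x ≤ gridTime hT m k := by
  rcases hT.eq_or_lt with h0 | hpos
  · rw [← Subtype.coe_le_coe]
    exact (gridCeil hT m x).2.2.trans (h0.symm.le.trans (gridTime hT m k).2.1)
  rw [← gridTime_min hT m k] at hx ⊢
  refine gridTime_mono hT m ?_
  rw [← Subtype.coe_le_coe] at hx
  simp only [gridTime, min_assoc, min_self] at hx
  rw [le_div_iff₀ (by positivity)] at hx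
  rw [Nat.ceil_le, div_le_iff₀ hpos]
  linarith

lemma gridCeil_antitone (x : Set.Icc (0 : ℝ) T) : Antitone fun m => gridCeil hT m x := by
  refine antitone_nat_of_succ_le fun m => ?_
  have h := le_gridCeil hT m x
  have h2 : gridCeil hT m x = gridTime hT (m + 1) (2 * ⌈2 ^ m * (x : ℝ) / T⌉₊) := by
    rw [gridTime_succ]; rfl
  rw [h2] at h ⊢
  exact gridCeil_le hT _ _ h

lemma coe_gridCeil_le (m : ℕ) (x : Set.Icc (0 : ℝ) T) :
    (gridCeil hT m x : ℝ) ≤ x + T / 2 ^ m := by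
  rcases hT.eq_or_lt with h0 | hpos
  · have := (gridCeil hT m x).2.2
    have := x.2.1
    subst h0
    simp
  simp only [gridCeil, gridTime]
  have h1 : ((min ⌈2 ^ m * (x : ℝ) / T⌉₊ (2 ^ m) : ℕ) : ℝ) ≤ 2 ^ m * (x : ℝ) / T + 1 :=
    le_trans (by exact_mod_cast min_le_left _ _)
      (Nat.ceil_lt_add_one (by have := x.2.1; positivity)).le
  calc T * ((min ⌈2 ^ m * (x : ℝ) / T⌉₊ (2 ^ m) : ℕ) : ℝ) / 2 ^ m
      ≤ T * (2 ^ m * (x : ℝ) / T + 1) / 2 ^ m := by gcongr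
    _ = x + T / 2 ^ m := by field_simp

lemma tendsto_div_two_pow (T : ℝ) : Tendsto (fun m : ℕ => T / 2 ^ m) atTop (𝓝 0) := by
  have := (tendsto_pow_atTop_nhds_zero_of_lt_one (r := (1 / 2 : ℝ)) (by norm_num)
    (by norm_num)).const_mul T
  simpa [div_eq_mul_inv] using this

lemma tendsto_gridCeil (x : Set.Icc (0 : ℝ) T) :
    Tendsto (fun m => gridCeil hT m x) atTop (𝓝[≥] x) := by
  refine tendsto_nhdsWithin_iff.2 ⟨?_, Eventually.of_forall fun m => le_gridCeil hT m x⟩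
  rw [tendsto_subtype_rng]
  refine tendsto_of_tendsto_of_tendsto_of_le_of_le tendsto_const_nhds ?_
    (fun m => le_gridCeil hT m x) fun m => coe_gridCeil_le hT m x
  simpa using (tendsto_div_two_pow T).const_add (x : ℝ)

variable {Ω : Type*} [m0 : MeasurableSpace Ω] {𝓕 : Filtration (Set.Icc (0 : ℝ) T) m0}

omit m0 in
lemma finite_range_gridCeil (m : ℕ) (τ : Ω → Set.Icc (0 : ℝ) T) :
    (Set.range fun ω => gridCeil hT m (τ ω)).Finite := by
  refine ((Finset.range (2 ^ m + 1)).image (gridTime hT m)).finite_toSet.subset ?_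
  rintro _ ⟨ω, rfl⟩
  simp only [gridCeil, Finset.coe_image, Set.mem_image]
  refine ⟨_, ?_, gridTime_min hT m _⟩
  simp

lemma isStop_gridCeil {τ : Ω → Set.Icc (0 : ℝ) T} (hτ : IsStop 𝓕 τ) (m : ℕ) :
    IsStop 𝓕 fun ω => gridCeil hT m (τ ω) := by
  intro i
  have : {ω | ((gridCeil hT m (τ ω) : Set.Icc (0 : ℝ) T) : WithTop (Set.Icc (0 : ℝ) T)) ≤ i}
      = ⋃ k : ℕ, ⋃ _ : gridTime hT m k ≤ i,
        {ω | (τ ω : WithTop (Set.Icc (0 : ℝ) T)) ≤ gridTime hT m k} := by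
    ext ω
    simp only [Set.mem_ofPred_eq, Set.mem_iUnion, WithTop.coe_le_coe, exists_prop]
    exact ⟨fun h => ⟨_, h, le_gridCeil hT m _⟩, fun ⟨k, hk, h⟩ => (gridCeil_le hT m k h).trans hk⟩
  rw [this]
  exact MeasurableSet.iUnion fun k => MeasurableSet.iUnion fun hk => 𝓕.mono hk _ (hτ _)

lemma measurable_stopped_of_finite_range {S : Set.Icc (0 : ℝ) T → Ω → ℝ} (hS : Adapted 𝓕 S)
    {τ : Ω → Set.Icc (0 : ℝ) T} (hτ : IsStop 𝓕 τ) (hfin : (Set.range τ).Finite) :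
    Measurable[hτ.measurableSpace] fun ω => S (τ ω) ω := by
  intro C hC
  have : (fun ω => S (τ ω) ω) ⁻¹' C
      = ⋃ t ∈ Set.range τ, (S t ⁻¹' C ∩ {ω | (τ ω : WithTop (Set.Icc (0 : ℝ) T)) = t}) := by
    ext ω
    simp only [Set.mem_preimage, Set.mem_range, Set.mem_iUnion, Set.mem_inter_iff,
      Set.mem_ofPred_eq, WithTop.coe_inj, exists_prop]
    constructor
    · exact fun h => ⟨τ ω, ⟨ω, rfl⟩, h, rfl⟩
    · rintro ⟨t, -, h, rfl⟩
      exact h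
  rw [this]
  refine MeasurableSet.biUnion hfin.countable fun t _ => ?_
  rw [hτ.measurableSet_inter_eq_iff]
  refine MeasurableSet.inter (hS t hC) (hτ.measurableSet_eq_of_countable_range ?_ t)
  refine ((hfin.image (WithTop.some)).subset ?_).countable
  rintro _ ⟨ω, rfl⟩
  exact ⟨τ ω, ⟨ω, rfl⟩, rfl⟩

lemma measurableSpace_le_gridCeil {τ : Ω → Set.Icc (0 : ℝ) T} (hτ : IsStop 𝓕 τ) (m : ℕ) :
    hτ.measurableSpace ≤ (isStop_gridCeil hT hτ m).measurableSpace :=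
  IsStoppingTime.measurableSpace_mono _ _ fun ω => WithTop.coe_le_coe.2 (le_gridCeil hT m (τ ω))

/-- For `j > i`, a fine enough grid rounds every value `τ ≤ i` to at most `j`. Hence `B ∩ {τ ≤ i}`
lies in `𝓕 j` for all `j > i`, and right-continuity puts it in `𝓕 i`. The endpoint `i = T` has no
right neighbours and is treated separately. -/
lemma iInf_measurableSpace_gridCeil_le (h𝓕 : 𝓕.IsRightContinuous)
    {τ : Ω → Set.Icc (0 : ℝ) T} (hτ : IsStop 𝓕 τ) {B : Set Ω}
    (hB : ∀ m, MeasurableSet[(isStop_gridCeil hT hτ m).measurableSpace] B) :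
    MeasurableSet[hτ.measurableSpace] B := by
  refine ⟨(hB 0).1, fun i => ?_⟩
  have hgt : ∀ j > i, MeasurableSet[𝓕 j] (B ∩ {ω | (τ ω : WithTop (Set.Icc (0 : ℝ) T)) ≤ i}) := by
    intro j hj
    have hij : (i : ℝ) < j := hj
    obtain ⟨m, hm⟩ := ((tendsto_div_two_pow T).eventually_lt_const (sub_pos.2 hij)).exists
    have : B ∩ {ω | (τ ω : WithTop (Set.Icc (0 : ℝ) T)) ≤ i}
        = B ∩ {ω | ((gridCeil hT m (τ ω) : Set.Icc (0 : ℝ) T) : WithTop (Set.Icc (0 : ℝ) T)) ≤ j}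
          ∩ {ω | (τ ω : WithTop (Set.Icc (0 : ℝ) T)) ≤ i} := by
      ext ω
      simp only [Set.mem_inter_iff, Set.mem_ofPred_eq, WithTop.coe_le_coe]
      refine ⟨fun h => ⟨⟨h.1, ?_⟩, h.2⟩, fun h => ⟨h.1.1, h.2⟩⟩
      have h1 := coe_gridCeil_le hT m (τ ω)
      have h2 : (τ ω : ℝ) ≤ i := h.2
      rw [← Subtype.coe_le_coe]
      linarith
    rw [this]
    exact ((hB m).2 j).inter (𝓕.mono hj.le _ (hτ i))
  rcases (i.2.2).eq_or_lt with hi | hi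
  · have : B ∩ {ω | (τ ω : WithTop (Set.Icc (0 : ℝ) T)) ≤ i}
        = B ∩ {ω | ((gridCeil hT 0 (τ ω) : Set.Icc (0 : ℝ) T) : WithTop (Set.Icc (0 : ℝ) T)) ≤ i}
      := by
      ext ω
      simp only [Set.mem_inter_iff, Set.mem_ofPred_eq, WithTop.coe_le_coe, ← Subtype.coe_le_coe, hi]
      exact and_congr_right fun _ => iff_of_true (τ ω).2.2 (gridCeil hT 0 (τ ω)).2.2
    rw [this]
    exact (hB 0).2 i
  · have hbot : (𝓝[>] i).NeBot :=
      mem_closure_iff_nhdsWithin_neBot.1 <| by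
        rw [closure_Ioi' ⟨⟨T, hT, le_rfl⟩, hi⟩]
        exact Set.self_mem_Ici
    have : MeasurableSet[𝓕.rightCont i] (B ∩ {ω | (τ ω : WithTop (Set.Icc (0 : ℝ) T)) ≤ i}) := by
      rw [Filtration.rightCont_eq_of_neBot_nhdsGT]
      simp only [MeasurableSpace.measurableSet_iInf]
      exact hgt
    exact h𝓕.RC i _ this

omit m0 in
lemma tendsto_stopped_gridCeil {S : Set.Icc (0 : ℝ) T → Ω → ℝ} (hS : IsCadlag S)
    (τ : Ω → Set.Icc (0 : ℝ) T) (ω : Ω) :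
    Tendsto (fun m => S (gridCeil hT m (τ ω)) ω) atTop (𝓝 (S (τ ω) ω)) :=
  Tendsto.comp (hS ω (τ ω)).1 (tendsto_gridCeil hT (τ ω))

/-- The approximations of level at least `m` are all measurable for the σ-algebra of level `m`,
hence so is their limit; this holds for every `m`, and those σ-algebras intersect in that of `τ`. -/
lemma measurable_stopped (h𝓕 : 𝓕.IsRightContinuous) {S : Set.Icc (0 : ℝ) T → Ω → ℝ}
    (hS : Adapted 𝓕 S) (hSc : IsCadlag S) {τ : Ω → Set.Icc (0 : ℝ) T} (hτ : IsStop 𝓕 τ) :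
    Measurable[hτ.measurableSpace] fun ω => S (τ ω) ω := by
  have hT : 0 ≤ T ∨ IsEmpty Ω := by
    rcases isEmpty_or_nonempty Ω with h | ⟨⟨ω⟩⟩
    · exact Or.inr h
    · exact Or.inl ((τ ω).2.1.trans (τ ω).2.2)
  rcases hT with hT | hempty
  · intro C hC
    refine iInf_measurableSpace_gridCeil_le hT h𝓕 hτ fun m => ?_
    refine @measurable_of_tendsto_metrizable Ω ℝ (isStop_gridCeil hT hτ m).measurableSpace _ _ _ _
      (fun k ω => S (gridCeil hT (k + m) (τ ω)) ω) _ (fun k => ?_) ?_ C hC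
    · refine (measurable_stopped_of_finite_range hS (isStop_gridCeil hT hτ (k + m))
        (finite_range_gridCeil hT _ τ)).mono ?_ le_rfl
      exact IsStoppingTime.measurableSpace_mono _ _ fun ω =>
        WithTop.coe_le_coe.2 (gridCeil_antitone hT (τ ω) (Nat.le_add_left m k))
    · rw [tendsto_pi_nhds]
      exact fun ω => (tendsto_add_atTop_iff_nat m).2 (tendsto_stopped_gridCeil hT hSc τ ω)
  · intro C _
    rw [Set.eq_empty_of_isEmpty ((fun ω => S (τ ω) ω) ⁻¹' C)]
    exact @MeasurableSet.empty _ hτ.measurableSpace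

end DyadicGrid

/-! ### Limits of lower bounds on conditional expectations -/

section CondExp

/-- Lower bounds on conditional expectations pass to the limit along decreasing σ-algebras. -/
lemma le_condExp_of_tendsto {Ω : Type*} {G' m0 : MeasurableSpace Ω} {Q : Measure Ω}
    [IsFiniteMeasure Q] {G : ℕ → MeasurableSpace Ω}
    (hG : ∀ n, G n ≤ m0) (hG' : ∀ n, G' ≤ G n) {f : ℕ → Ω → ℝ} {g Z : Ω → ℝ}
    (hg : Measurable[G'] g) (hZ : Integrable Z Q) (hf : ∀ n, f n ≤ᵐ[Q] Q[Z|G n])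
    (hfg : ∀ ω, Tendsto (fun n => f n ω) atTop (𝓝 (g ω))) :
    g ≤ᵐ[Q] Q[Z|G'] := by
  have hG'0 : G' ≤ m0 := (hG' 0).trans (hG 0)
  set W := Q[Z|G'] with hW
  have hWm : Measurable[G'] W := stronglyMeasurable_condExp.measurable
  set B := {ω | W ω < g ω} with hB
  have hBm' : MeasurableSet[G'] B := by
    have : B = (fun ω => g ω - W ω) ⁻¹' Set.Ioi 0 := by ext; simp [hB]
    rw [this]
    exact (hg.sub hWm) measurableSet_Ioi
  have hBm : MeasurableSet B := hG'0 _ hBm'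
  -- On the bad set `B`, the excess of `g` over `W` is truncated at `1` because `g` need not be
  -- integrable. Then `c = W + d ≤ g` on `B`, and `(c - Q[Z|G n])⁺` tends to `0` there almost
  -- surely, hence in L¹ by uniform integrability. As `B` belongs to `G'`, the integral of `d` is at
  -- most that limit.
  set d : Ω → ℝ := B.indicator fun ω => min (g ω - W ω) 1 with hd
  have hdm : Measurable d :=
    Measurable.indicator (((hg.sub hWm).mono hG'0 le_rfl).min measurable_const) hBm
  have hd0 : ∀ ω, 0 ≤ d ω := by
    intro ω
    refine Set.indicator_nonneg (fun ω hω => ?_) ω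
    exact le_min (sub_nonneg.2 (le_of_lt hω)) zero_le_one
  have hdint : Integrable d Q := by
    refine Integrable.of_bound hdm.aestronglyMeasurable 1 (ae_of_all _ fun ω => ?_)
    rw [Real.norm_eq_abs, abs_of_nonneg (hd0 ω)]
    exact Set.indicator_le' (fun ω _ => min_le_right _ _) (fun _ _ => zero_le_one) ω
  set c : Ω → ℝ := W + d with hc
  have hcint : Integrable c Q := integrable_condExp.add hdint
  set D : ℕ → Ω → ℝ := fun n => B.indicator fun ω => max (c ω - Q[Z|G n] ω) 0 with hD
  have hDint : ∀ n, Integrable (D n) Q := fun n =>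
    ((hcint.sub integrable_condExp).pos_part).indicator hBm
  have hUI : UnifIntegrable D 1 Q := by
    have h1 := (unifIntegrable_const (ι := ℕ) le_rfl ENNReal.one_ne_top
      (memLp_one_iff_integrable.2 hcint)).sub
      (hZ.uniformIntegrable_condExp hG).unifIntegrable le_rfl
      (fun _ => hcint.aestronglyMeasurable) fun _ => integrable_condExp.aestronglyMeasurable
    intro ε hε
    obtain ⟨δ, hδ, h⟩ := h1 hε
    refine ⟨δ, hδ, fun n s hs hQs => le_trans (eLpNorm_mono fun ω => ?_) (h n s hs hQs)⟩
    by_cases hωs : ω ∈ s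
    · by_cases hωB : ω ∈ B
      · simp only [hωs, Set.indicator_of_mem, hD, hωB, Pi.sub_apply, Real.norm_eq_abs]
        rw [abs_of_nonneg (le_max_right _ _)]
        exact max_le (le_abs_self _) (abs_nonneg _)
      · simp [hωs, hD, hωB]
    · simp [hωs]
  have hlim : ∀ᵐ ω ∂Q, Tendsto (fun n => D n ω) atTop (𝓝 0) := by
    filter_upwards [ae_all_iff.2 hf] with ω hω
    by_cases hωB : ω ∈ B
    · have hcg : c ω ≤ g ω := by
        simp only [hc, hd, Pi.add_apply, Set.indicator_of_mem hωB]
        linarith [min_le_left (g ω - W ω) 1]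
      have h1 : Tendsto (fun n => max (c ω - f n ω) 0) atTop (𝓝 0) := by
        have := ((hfg ω).const_sub (c ω)).max (tendsto_const_nhds (x := (0 : ℝ)))
        rwa [max_eq_right (sub_nonpos.2 hcg)] at this
      refine squeeze_zero (fun n => ?_) (fun n => ?_) h1
      · simp only [hD, Set.indicator_of_mem hωB]
        exact le_max_right _ _
      · simp only [hD, Set.indicator_of_mem hωB]
        exact max_le_max_right _ (sub_le_sub_left (hω n) _)
    · simp [hD, hωB]
  have hL1 := tendsto_Lp_finite_of_tendsto_ae le_rfl ENNReal.one_ne_top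
    (fun n => (hDint n).aestronglyMeasurable) MemLp.zero hUI hlim
  have hint := tendsto_integral_of_L1' (0 : Ω → ℝ) aestronglyMeasurable_zero
    (Eventually.of_forall hDint) hL1
  simp only [Pi.zero_apply, integral_zero] at hint
  have hge : ∀ n, ∫ ω in B, d ω ∂Q ≤ ∫ ω, D n ω ∂Q := by
    intro n
    have h1 : ∫ ω in B, Q[Z|G n] ω ∂Q = ∫ ω in B, W ω ∂Q := by
      rw [setIntegral_condExp (hG n) hZ (hG' n _ hBm'), setIntegral_condExp hG'0 hZ hBm']
    have h2 : ∫ ω in B, d ω ∂Q = ∫ ω in B, (c ω - Q[Z|G n] ω) ∂Q := by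
      rw [integral_sub hcint.integrableOn integrable_condExp.integrableOn, h1, hc]
      simp only [Pi.add_apply]
      rw [integral_add integrable_condExp.integrableOn hdint.integrableOn]
      ring
    rw [h2, integral_indicator hBm]
    exact setIntegral_mono (hcint.sub integrable_condExp).integrableOn
      (hcint.sub integrable_condExp).pos_part.integrableOn fun ω => le_max_left _ _
  have hd_nonpos : ∫ ω in B, d ω ∂Q ≤ 0 := ge_of_tendsto' hint hge
  have hd_all : ∫ ω, d ω ∂Q ≤ 0 :=
    (setIntegral_eq_integral_of_forall_compl_eq_zero
      fun ω hω => Set.indicator_of_notMem hω _).symm.trans_le hd_nonpos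
  have hdz : d =ᵐ[Q] 0 :=
    (integral_eq_zero_iff_of_nonneg hd0 hdint).1 (le_antisymm hd_all (integral_nonneg hd0))
  filter_upwards [hdz] with ω hω
  by_contra hcon
  have hωB : ω ∈ B := not_le.1 hcon
  simp only [hd, Set.indicator_of_mem hωB, Pi.zero_apply] at hω
  have : 0 < min (g ω - W ω) 1 := lt_min (sub_pos.2 hωB) one_pos
  exact this.ne' hω

end CondExp

/-! ### Price bounds at stopping times -/

section StoppedBound

variable {T : ℝ} {Ω : Type*} [m0 : MeasurableSpace Ω] {𝓕 : Filtration (Set.Icc (0 : ℝ) T) m0}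
  {Q : Measure Ω} [IsFiniteMeasure Q] {S : Set.Icc (0 : ℝ) T → Ω → ℝ} {Z : Ω → ℝ}

/-- On `{τ = t}` conditioning on the past of `τ` agrees with conditioning on `𝓕 t`. -/
lemma stopped_le_condExp_of_finite_range {τ : Ω → Set.Icc (0 : ℝ) T} (hτ : IsStop 𝓕 τ)
    (hfin : (Set.range τ).Finite) (h : ∀ t ∈ Set.range τ, S t ≤ᵐ[Q] Q[Z|𝓕 t]) :
    (fun ω => S (τ ω) ω) ≤ᵐ[Q] Q[Z|hτ.measurableSpace] := by
  have h1 : ∀ t : Set.Icc (0 : ℝ) T, ∀ᵐ ω ∂Q, (τ ω : WithTop (Set.Icc (0 : ℝ) T)) = t →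
      Q[Z|hτ.measurableSpace] ω = Q[Z|𝓕 t] ω := by
    intro t
    have := condExp_stopping_time_ae_eq_restrict_eq (μ := Q) (f := Z) hτ t
    rwa [EventuallyEq, ae_restrict_iff' (hτ.measurableSpace_le _ (hτ.measurableSet_eq' t))] at this
  filter_upwards [(ae_ball_iff hfin.countable).2 h,
    (ae_ball_iff hfin.countable).2 fun t _ => h1 t] with ω h2 h3
  have := h2 (τ ω) ⟨ω, rfl⟩
  rwa [← h3 (τ ω) ⟨ω, rfl⟩ rfl] at this

/-- A lower bound at the dyadic times extends to all stopping times. -/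
lemma stopped_le_condExp (hT : 0 ≤ T) (h𝓕 : 𝓕.IsRightContinuous) (hS : Adapted 𝓕 S)
    (hSc : IsCadlag S) (hZ : Integrable Z Q)
    (h : ∀ m k, S (gridTime hT m k) ≤ᵐ[Q] Q[Z|𝓕 (gridTime hT m k)])
    {τ : Ω → Set.Icc (0 : ℝ) T} (hτ : IsStop 𝓕 τ) :
    (fun ω => S (τ ω) ω) ≤ᵐ[Q] Q[Z|hτ.measurableSpace] := by
  refine le_condExp_of_tendsto (fun m => (isStop_gridCeil hT hτ m).measurableSpace_le)
    (fun m => measurableSpace_le_gridCeil hT hτ m) (measurable_stopped h𝓕 hS hSc hτ) hZ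
    (fun m => ?_) (tendsto_stopped_gridCeil hT hSc τ)
  refine stopped_le_condExp_of_finite_range (isStop_gridCeil hT hτ m)
    (finite_range_gridCeil hT m τ) ?_
  rintro _ ⟨ω, rfl⟩
  exact h m _

omit m0 in
lemma IsCadlag.neg (hS : IsCadlag S) : IsCadlag (-S) := fun ω t =>
  ⟨(hS ω t).1.neg, (hS ω t).2.imp' Neg.neg fun _ h => h.neg⟩

lemma condExp_le_stopped (hT : 0 ≤ T) (h𝓕 : 𝓕.IsRightContinuous) (hS : Adapted 𝓕 S)
    (hSc : IsCadlag S) (hZ : Integrable Z Q)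
    (h : ∀ m k, Q[Z|𝓕 (gridTime hT m k)] ≤ᵐ[Q] S (gridTime hT m k))
    {τ : Ω → Set.Icc (0 : ℝ) T} (hτ : IsStop 𝓕 τ) :
    Q[Z|hτ.measurableSpace] ≤ᵐ[Q] fun ω => S (τ ω) ω := by
  have := stopped_le_condExp (S := -S) (Z := -Z) hT h𝓕 (fun t => (hS t).neg) hSc.neg hZ.neg
    (fun m k => by
      filter_upwards [h m k, condExp_neg (μ := Q) Z (𝓕 (gridTime hT m k))] with ω h1 h2
      simpa [h2] using h1) hτ
  filter_upwards [this, condExp_neg (μ := Q) Z hτ.measurableSpace] with ω h1 h2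
  rw [h2] at h1
  simpa using h1

end StoppedBound

/-! ### Snell envelopes of bid and ask on a finite grid -/

section Snell

variable {T : ℝ} {Ω : Type*} [m0 : MeasurableSpace Ω] {𝓕 : Filtration (Set.Icc (0 : ℝ) T) m0}
  {Q : Measure Ω} [IsFiniteMeasure Q]

/-- `X` is the conditional expectation given `𝓕 t` of the value of `S` at a simple stopping time
that is not before `t`. -/
def IsStoppedCondExp (𝓕 : Filtration (Set.Icc (0 : ℝ) T) m0) (Q : Measure Ω)
    (S : Set.Icc (0 : ℝ) T → Ω → ℝ) (t : Set.Icc (0 : ℝ) T) (X : Ω → ℝ) : Prop :=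
  ∃ v : Ω → Set.Icc (0 : ℝ) T, IsStop 𝓕 v ∧ (Set.range v).Finite ∧ (∀ ω, t ≤ v ω) ∧
    Integrable (fun ω => S (v ω) ω) Q ∧ Q[fun ω => S (v ω) ω|𝓕 t] =ᵐ[Q] X

variable {S : Set.Icc (0 : ℝ) T → Ω → ℝ} {s t : Set.Icc (0 : ℝ) T} {X : Ω → ℝ}

lemma IsStoppedCondExp.self (hS : Adapted 𝓕 S) (hSint : ∀ t, Integrable (S t) Q)
    (t : Set.Icc (0 : ℝ) T) : IsStoppedCondExp 𝓕 Q S t (S t) := by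
  refine ⟨fun _ => t, isStoppingTime_const 𝓕 t, Set.toFinite _ |>.subset Set.range_const_subset,
    fun _ => le_rfl, hSint t, ?_⟩
  exact (condExp_of_stronglyMeasurable (𝓕.le t) (hS t).stronglyMeasurable (hSint t)).eventuallyEq

lemma IsStoppedCondExp.condExp (hst : s ≤ t) (hX : IsStoppedCondExp 𝓕 Q S t X) :
    IsStoppedCondExp 𝓕 Q S s (Q[X|𝓕 s]) := by
  obtain ⟨v, hv, hfin, htv, hint, heq⟩ := hX
  refine ⟨v, hv, hfin, fun ω => hst.trans (htv ω), hint, ?_⟩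
  exact (condExp_condExp_of_le (𝓕.mono hst) (𝓕.le t)).symm.trans (condExp_congr_ae heq)

omit [IsFiniteMeasure Q] in
lemma IsStoppedCondExp.neg (hX : IsStoppedCondExp 𝓕 Q S t X) :
    IsStoppedCondExp 𝓕 Q (-S) t (-X) := by
  obtain ⟨v, hv, hfin, htv, hint, heq⟩ := hX
  exact ⟨v, hv, hfin, htv, hint.neg, (condExp_neg (fun ω => S (v ω) ω) (𝓕 t)).trans heq.neg⟩

/-- One step of the Snell recursion: stop at `t` where `X ≤ S t`, and follow `v` elsewhere. The
choice is made on an event of `𝓕 t`, so the new time is again a simple stopping time. -/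
lemma IsStoppedCondExp.max (hS : Adapted 𝓕 S) (hSint : ∀ t, Integrable (S t) Q)
    (hXm : StronglyMeasurable[𝓕 t] X) (hX : IsStoppedCondExp 𝓕 Q S t X) :
    IsStoppedCondExp 𝓕 Q S t (fun ω => max (S t ω) (X ω)) := by
  classical
  obtain ⟨v, hv, hfin, htv, hint, heq⟩ := hX
  set B : Set Ω := {ω | X ω ≤ S t ω} with hB
  have hBt : MeasurableSet[𝓕 t] B := by
    have : B = (fun ω => S t ω - X ω) ⁻¹' Set.Ici 0 := by ext; simp [hB]
    rw [this]
    exact ((hS t).sub hXm.measurable) measurableSet_Ici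
  have hBm : MeasurableSet B := 𝓕.le t _ hBt
  have hval : (fun ω => S (B.piecewise (fun _ => t) v ω) ω)
      = B.indicator (S t) + Bᶜ.indicator fun ω => S (v ω) ω := by
    ext ω
    by_cases hω : ω ∈ B <;> simp [hω]
  have hint1 : Integrable (B.indicator (S t)) Q := (hSint t).indicator hBm
  have hint2 : Integrable (Bᶜ.indicator fun ω => S (v ω) ω) Q := hint.indicator hBm.compl
  refine ⟨B.piecewise (fun _ => t) v, ?_, ?_, ?_, ?_, ?_⟩
  · have := (isStoppingTime_const 𝓕 t).piecewise_of_le hv (fun _ => le_rfl)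
      (fun ω => WithTop.coe_le_coe.2 (htv ω)) hBt
    convert this using 1
    ext1 ω
    by_cases hω : ω ∈ B <;> simp [hω]
  · refine ((Set.finite_singleton t).union hfin).subset ?_
    rintro _ ⟨ω, rfl⟩
    by_cases hω : ω ∈ B
    · simp [hω]
    · simp [hω]
  · intro ω
    by_cases hω : ω ∈ B
    · simp [hω]
    · simpa [hω] using htv ω
  · rw [hval]
    exact hint1.add hint2
  · rw [hval]
    have hself : Q[S t|𝓕 t] = S t :=
      condExp_of_stronglyMeasurable (𝓕.le t) (hS t).stronglyMeasurable (hSint t)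
    filter_upwards [condExp_add hint1 hint2 (𝓕 t), condExp_indicator (hSint t) hBt,
      condExp_indicator hint hBt.compl, heq] with ω h1 h2 h3 h4
    rw [h1, Pi.add_apply, h2, h3, hself]
    by_cases hω : ω ∈ B
    · have : X ω ≤ S t ω := hω
      simp [hω, this]
    · have : S t ω ≤ X ω := (not_le.1 hω).le
      simp [hω, this, h4]

lemma IsStoppedCondExp.min (hS : Adapted 𝓕 S) (hSint : ∀ t, Integrable (S t) Q)
    (hXm : StronglyMeasurable[𝓕 t] X) (hX : IsStoppedCondExp 𝓕 Q S t X) :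
    IsStoppedCondExp 𝓕 Q S t (fun ω => min (S t ω) (X ω)) := by
  have h := (IsStoppedCondExp.max (S := -S) (fun t => (hS t).neg) (fun t => (hSint t).neg) hXm.neg
    hX.neg).neg
  rw [neg_neg] at h
  convert h using 1
  ext ω
  simp [max_neg_neg]

/-- If stopped bid prices are conditionally below the ask price and stopped ask prices are
conditionally above the bid price, then along a finite grid some closed martingale lies between bid
and ask. The martingale can be started at any value between the two Snell envelopes. -/
lemma exists_martingale_between_grid {Sa Sb : Set.Icc (0 : ℝ) T → Ω → ℝ} (hSa : Adapted 𝓕 Sa)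
    (hSb : Adapted 𝓕 Sb) (hSaint : ∀ t, Integrable (Sa t) Q) (hSbint : ∀ t, Integrable (Sb t) Q)
    (hle : ∀ t, Sb t ≤ᵐ[Q] Sa t) (hbid : ∀ t X, IsStoppedCondExp 𝓕 Q Sb t X → X ≤ᵐ[Q] Sa t)
    (hask : ∀ t X, IsStoppedCondExp 𝓕 Q Sa t X → Sb t ≤ᵐ[Q] X) (n : ℕ) :
    ∀ t : ℕ → Set.Icc (0 : ℝ) T, Monotone t → ∃ X Y : Ω → ℝ,
      StronglyMeasurable[𝓕 (t 0)] X ∧ StronglyMeasurable[𝓕 (t 0)] Y ∧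
      Integrable X Q ∧ Integrable Y Q ∧
      IsStoppedCondExp 𝓕 Q Sb (t 0) X ∧ IsStoppedCondExp 𝓕 Q Sa (t 0) Y ∧ X ≤ᵐ[Q] Y ∧
      ∀ W, StronglyMeasurable[𝓕 (t 0)] W → Integrable W Q → X ≤ᵐ[Q] W → W ≤ᵐ[Q] Y →
        ∃ Z, Integrable Z Q ∧ Q[Z|𝓕 (t 0)] =ᵐ[Q] W ∧ Sb (t n) ≤ᵐ[Q] Z ∧ Z ≤ᵐ[Q] Sa (t n) ∧
          ∀ k ≤ n, Sb (t k) ≤ᵐ[Q] Q[Z|𝓕 (t k)] ∧ Q[Z|𝓕 (t k)] ≤ᵐ[Q] Sa (t k) := by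
  induction n with
  | zero =>
    intro t _
    refine ⟨Sb (t 0), Sa (t 0), (hSb _).stronglyMeasurable, (hSa _).stronglyMeasurable, hSbint _,
      hSaint _, .self hSb hSbint _, .self hSa hSaint _, hle _, fun W hWm hWint hXW hWY => ?_⟩
    have hW : Q[W|𝓕 (t 0)] = W := condExp_of_stronglyMeasurable (𝓕.le _) hWm hWint
    refine ⟨W, hWint, hW.eventuallyEq, hXW, hWY, fun k hk => ?_⟩
    rw [Nat.le_zero.1 hk, hW]
    exact ⟨hXW, hWY⟩
  | succ n ih =>
    intro t ht
    obtain ⟨X, Y, hXm, hYm, hXint, hYint, hX, hY, hXY, hZ⟩ :=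
      ih (fun k => t (k + 1)) fun k l hkl => ht (Nat.succ_le_succ hkl)
    simp only [zero_add] at hXm hYm hX hY hZ
    have h01 : t 0 ≤ t 1 := ht zero_le_one
    set E := Q[X|𝓕 (t 0)] with hE
    set F := Q[Y|𝓕 (t 0)] with hF
    have hEm : StronglyMeasurable[𝓕 (t 0)] E := stronglyMeasurable_condExp
    have hFm : StronglyMeasurable[𝓕 (t 0)] F := stronglyMeasurable_condExp
    have hEF : E ≤ᵐ[Q] F := condExp_mono hXint hYint hXY
    have hE' := hX.condExp h01
    have hF' := hY.condExp h01
    refine ⟨fun ω => max (Sb (t 0) ω) (E ω), fun ω => min (Sa (t 0) ω) (F ω),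
      ((hSb _).max hEm.measurable).stronglyMeasurable,
      ((hSa _).min hFm.measurable).stronglyMeasurable,
      (hSbint _).sup integrable_condExp, (hSaint _).inf integrable_condExp,
      hE'.max hSb hSbint hEm, hF'.min hSa hSaint hFm, ?_, ?_⟩
    -- The four comparisons behind `max ≤ min`: bid and ask, the two continuation values, and each
    -- continuation value against the opposite price; the last two hold because `E` and `F` are
    -- conditional expectations of stopped prices.
    · filter_upwards [hle (t 0), hEF, hbid _ _ hE', hask _ _ hF'] with ω h1 h2 h3 h4
      exact max_le (le_min h1 h4) (le_min h3 h2)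
    · intro W hWm hWint hXW hWY
      -- The weight with `W = E + l (F - E)`, known at `t 0`. Using it at the next date gives `X + l
      -- (Y - X)`, between `X` and `Y`, with conditional expectation `W`. Where `E = F`, also `W =
      -- E`, so the default value `0` of the quotient is harmless.
      set l : Ω → ℝ := fun ω => (W ω - E ω) / (F ω - E ω) with hl
      have hlm : StronglyMeasurable[𝓕 (t 0)] l :=
        ((hWm.measurable.sub hEm.measurable).div
          (hFm.measurable.sub hEm.measurable)).stronglyMeasurable
      have hEWF : ∀ᵐ ω ∂Q, E ω ≤ W ω ∧ W ω ≤ F ω := by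
        filter_upwards [hXW, hWY] with ω h1 h2
        exact ⟨(le_max_right _ _).trans h1, h2.trans (min_le_right _ _)⟩
      have hl01 : ∀ᵐ ω ∂Q, 0 ≤ l ω ∧ l ω ≤ 1 := by
        filter_upwards [hEWF] with ω h
        exact ⟨div_nonneg (by linarith) (by linarith),
          div_le_one_of_le₀ (by linarith) (by linarith)⟩
      have hprod : Integrable (l * (Y - X)) Q := by
        refine (hYint.sub hXint).bdd_mul (c := 1)
          (hlm.mono (𝓕.le _)).aestronglyMeasurable ?_
        filter_upwards [hl01] with ω h
        rw [Real.norm_eq_abs, abs_of_nonneg h.1]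
        exact h.2
      obtain ⟨Z, hZint, hZW, hZ1, hZ2, hZ3⟩ := hZ (X + l * (Y - X))
        (hXm.add ((hlm.mono (𝓕.mono h01)).mul (hYm.sub hXm))) (hXint.add hprod)
        (by
          filter_upwards [hl01, hXY] with ω h1 h2
          simp only [Pi.add_apply, Pi.mul_apply, Pi.sub_apply]
          nlinarith [h1.1])
        (by
          filter_upwards [hl01, hXY] with ω h1 h2
          simp only [Pi.add_apply, Pi.mul_apply, Pi.sub_apply]
          nlinarith [h1.2])
      have hZW0 : Q[Z|𝓕 (t 0)] =ᵐ[Q] W := by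
        have h1 := (condExp_condExp_of_le (μ := Q) (f := Z) (𝓕.mono h01) (𝓕.le (t 1))).symm.trans
          (condExp_congr_ae hZW)
        filter_upwards [h1, condExp_add hXint hprod (𝓕 (t 0)),
          condExp_mul_of_stronglyMeasurable_left hlm hprod (hYint.sub hXint),
          condExp_sub hYint hXint (𝓕 (t 0)), hEWF] with ω h1 h2 h3 h4 h5
        rw [h1, h2, Pi.add_apply, h3, Pi.mul_apply, h4, Pi.sub_apply, ← hE, ← hF]
        simp only [hl]
        by_cases h0 : F ω - E ω = 0
        · rw [h0, mul_zero, add_zero]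
          linarith
        · rw [div_mul_cancel₀ _ h0]
          ring
      refine ⟨Z, hZint, hZW0, hZ1, hZ2, fun k hk => ?_⟩
      cases k with
      | zero =>
        constructor
        · filter_upwards [hZW0, hXW] with ω h1 h2
          rw [h1]
          exact (le_max_left _ _).trans h2
        · filter_upwards [hZW0, hWY] with ω h1 h2
          rw [h1]
          exact h2.trans (min_le_left _ _)
      | succ k => exact hZ3 k (Nat.succ_le_succ_iff.1 hk)

end Snell

/-! ### Inequalities tested on sets and in L² -/

section SetIntegral

lemma ae_le_of_forall_setIntegral_le_of_stronglyMeasurable {Ω : Type*} {G m0 : MeasurableSpace Ω}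
    {Q : Measure Ω} (hG : G ≤ m0) {f g : Ω → ℝ} (hf : StronglyMeasurable[G] f)
    (hg : StronglyMeasurable[G] g) (hfi : Integrable f Q) (hgi : Integrable g Q)
    (h : ∀ B, MeasurableSet[G] B → ∫ ω in B, f ω ∂Q ≤ ∫ ω in B, g ω ∂Q) : f ≤ᵐ[Q] g := by
  refine (StronglyMeasurable.ae_le_trim_iff hG hf hg).1 ?_
  refine ae_le_of_forall_setIntegral_le (hfi.trim hG hf) (hgi.trim hG hg) fun B hB _ => ?_
  rw [← setIntegral_trim hG hf hB, ← setIntegral_trim hG hg hB]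
  exact h B hB

lemma inner_toLp_indicator {Ω : Type*} [MeasurableSpace Ω] {Q : Measure Ω} {w : Ω → ℝ}
    (hw : MemLp w 2 Q) {B : Set Ω} (hB : MeasurableSet B) (g : Lp ℝ 2 Q) :
    inner ℝ ((hw.indicator hB).toLp _) g = ∫ ω in B, w ω * g ω ∂Q := by
  rw [L2.inner_def, ← integral_indicator hB]
  refine integral_congr_ae ?_
  filter_upwards [(hw.indicator hB).coeFn_toLp] with ω h
  rw [h]
  by_cases hω : ω ∈ B
  · simp [hω, mul_comm]
  · simp [hω]

end SetIntegral

/-! ### One martingale for all dyadic grids -/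

section Existence

variable {T : ℝ} {Ω : Type*} [m0 : MeasurableSpace Ω] {𝓕 : Filtration (Set.Icc (0 : ℝ) T) m0}
  {Q : Measure Ω} [IsFiniteMeasure Q]

/-- A closed martingale lying between bid and ask at all dyadic times. -/
lemma exists_martingale_between {Sa Sb : Set.Icc (0 : ℝ) T → Ω → ℝ} (hT : 0 ≤ T)
    (hSa : Adapted 𝓕 Sa) (hSb : Adapted 𝓕 Sb) (hSaint : ∀ t, Integrable (Sa t) Q)
    (hSbint : ∀ t, Integrable (Sb t) Q)
    (hle : ∀ t, Sb t ≤ᵐ[Q] Sa t) (hbid : ∀ t X, IsStoppedCondExp 𝓕 Q Sb t X → X ≤ᵐ[Q] Sa t)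
    (hask : ∀ t X, IsStoppedCondExp 𝓕 Q Sa t X → Sb t ≤ᵐ[Q] X) :
    ∃ Z, Integrable Z Q ∧ ∀ m k, Sb (gridTime hT m k) ≤ᵐ[Q] Q[Z|𝓕 (gridTime hT m k)] ∧
      Q[Z|𝓕 (gridTime hT m k)] ≤ᵐ[Q] Sa (gridTime hT m k) := by
  have hlevel : ∀ m, ∃ Z, Integrable Z Q ∧ Sb ⟨T, hT, le_rfl⟩ ≤ᵐ[Q] Z ∧
      Z ≤ᵐ[Q] Sa ⟨T, hT, le_rfl⟩ ∧ ∀ k, Sb (gridTime hT m k) ≤ᵐ[Q] Q[Z|𝓕 (gridTime hT m k)] ∧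
      Q[Z|𝓕 (gridTime hT m k)] ≤ᵐ[Q] Sa (gridTime hT m k) := by
    intro m
    obtain ⟨X, Y, hXm, -, hXint, -, -, -, hXY, h⟩ := exists_martingale_between_grid hSa hSb hSaint
      hSbint hle hbid hask (2 ^ m) (gridTime hT m) (gridTime_mono hT m)
    obtain ⟨Z, hZ, -, h1, h2, h3⟩ := h X hXm hXint EventuallyLE.rfl hXY
    rw [gridTime_last] at h1 h2
    refine ⟨Z, hZ, h1, h2, fun k => ?_⟩
    have := h3 (min k (2 ^ m)) (min_le_right _ _)
    rwa [gridTime_min] at this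
  set a := Sb ⟨T, hT, le_rfl⟩ with ha
  set b := Sa ⟨T, hT, le_rfl⟩ with hb
  have hai : Integrable a Q := hSbint _
  have hbi : Integrable b Q := hSaint _
  -- Integrability of `b - a` puts `s` in L². Every `Z` between `a` and `b` is `a + s q` with `q =
  -- (Z - a) / s` and `|q| ≤ s`, so the candidates for `q` lie in a fixed L² ball.
  set s : Ω → ℝ := fun ω => Real.sqrt (b ω - a ω) with hs
  have ham : Measurable a := Measurable.mono (hSb _) (𝓕.le _) le_rfl
  have hbm : Measurable b := Measurable.mono (hSa _) (𝓕.le _) le_rfl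
  have hsm : Measurable s := (hbm.sub ham).sqrt
  have hab : a ≤ᵐ[Q] b := hle _
  have hsq : ∀ᵐ ω ∂Q, s ω ^ 2 = b ω - a ω := by
    filter_upwards [hab] with ω h
    exact Real.sq_sqrt (sub_nonneg.2 h)
  have hsL2 : MemLp s 2 Q := by
    rw [memLp_two_iff_integrable_sq hsm.aestronglyMeasurable]
    exact (hbi.sub hai).congr (hsq.mono fun ω h => h.symm)
  -- Each constraint compares `∫_B (a + s q) = ∫_B a + ⟨1_B s, q⟩` with the integral of the ask or
  -- the bid over a set `B` known at a grid time.
  set C : ℕ → Set (Lp ℝ 2 Q × ℝ) := fun m => {p | ∃ (B : Set Ω) (hB : MeasurableSet B) (k : ℕ),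
    MeasurableSet[𝓕 (gridTime hT m k)] B ∧
    (p = ((hsL2.indicator hB).toLp _,
        ∫ ω in B, Sa (gridTime hT m k) ω ∂Q - ∫ ω in B, a ω ∂Q) ∨
      p = (-(hsL2.indicator hB).toLp _,
        ∫ ω in B, a ω ∂Q - ∫ ω in B, Sb (gridTime hT m k) ω ∂Q))} with hC
  have hCmono : Monotone C := by
    refine monotone_nat_of_le_succ fun m p => ?_
    rintro ⟨B, hB, k, hBk, hp⟩
    rw [← gridTime_succ] at hBk hp
    exact ⟨B, hB, 2 * k, hBk, hp⟩
  obtain ⟨g, hg⟩ := exists_forall_inner_le C hCmono ‖hsL2.toLp s‖ <| by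
    intro m
    obtain ⟨Z, hZ, haZ, hZb, hZk⟩ := hlevel m
    set q : Ω → ℝ := fun ω => (Z ω - a ω) / s ω with hq
    have hsq' : ∀ᵐ ω ∂Q, s ω * q ω = Z ω - a ω ∧ |q ω| ≤ s ω := by
      filter_upwards [hsq, haZ, hZb] with ω h1 h2 h3
      have hs0 : 0 ≤ s ω := Real.sqrt_nonneg _
      rcases hs0.eq_or_lt with h0 | hpos
      · rw [← h0] at h1
        simp only [hq, ← h0]
        constructor
        · linarith
        · simp
      · refine ⟨mul_div_cancel₀ _ hpos.ne', ?_⟩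
        rw [abs_of_nonneg (div_nonneg (sub_nonneg.2 h2) hs0), div_le_iff₀ hpos]
        nlinarith
    have hqm : AEStronglyMeasurable q Q :=
      ((hZ.aestronglyMeasurable.aemeasurable.sub
        hai.aestronglyMeasurable.aemeasurable).div hsm.aemeasurable).aestronglyMeasurable
    have hqs : ∀ᵐ ω ∂Q, ‖q ω‖ ≤ ‖s ω‖ :=
      hsq'.mono fun ω h => h.2.trans (le_abs_self _)
    have hqL2 : MemLp q 2 Q := hsL2.mono hqm hqs
    refine ⟨hqL2.toLp q, ?_, ?_⟩
    · rw [Lp.norm_toLp, Lp.norm_toLp]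
      exact ENNReal.toReal_mono hsL2.eLpNorm_ne_top (eLpNorm_mono_ae hqs)
    · rintro p ⟨B, hB, k, hBk, hp⟩
      have hinner : inner ℝ ((hsL2.indicator hB).toLp _) (hqL2.toLp q)
          = ∫ ω in B, Q[Z|𝓕 (gridTime hT m k)] ω ∂Q - ∫ ω in B, a ω ∂Q := by
        rw [inner_toLp_indicator hsL2 hB, setIntegral_condExp (𝓕.le _) hZ hBk,
          ← integral_sub hZ.integrableOn hai.integrableOn]
        refine setIntegral_congr_ae hB ?_
        filter_upwards [hsq', hqL2.coeFn_toLp] with ω h1 h2 _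
        rw [h2, h1.1]
      have h1 := setIntegral_mono_ae (s := B) (hSbint _).integrableOn
        integrable_condExp.integrableOn (hZk k).1
      have h2 := setIntegral_mono_ae (s := B) integrable_condExp.integrableOn
        (hSaint _).integrableOn (hZk k).2
      rcases hp with rfl | rfl
      · simp only
        rw [hinner]
        linarith
      · simp only
        rw [inner_neg_left, hinner]
        linarith
  have hsg : Integrable (fun ω => s ω * g ω) Q := hsL2.integrable_mul (Lp.memLp g)
  have hZint : Integrable (fun ω => a ω + s ω * g ω) Q := hai.add hsg
  refine ⟨_, hZint, fun m k => ?_⟩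
  have hB : ∀ B, MeasurableSet[𝓕 (gridTime hT m k)] B →
      ∫ ω in B, Q[fun ω => a ω + s ω * g ω|𝓕 (gridTime hT m k)] ω ∂Q
        = ∫ ω in B, a ω ∂Q + ∫ ω in B, s ω * g ω ∂Q := by
    intro B hB
    rw [setIntegral_condExp (𝓕.le _) hZint hB, integral_add hai.integrableOn hsg.integrableOn]
  constructor
  · refine ae_le_of_forall_setIntegral_le_of_stronglyMeasurable (𝓕.le _)
      (hSb _).stronglyMeasurable stronglyMeasurable_condExp (hSbint _) integrable_condExp
      fun B hBk => ?_
    have := hg m _ ⟨B, 𝓕.le _ _ hBk, k, hBk, Or.inr rfl⟩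
    rw [inner_neg_left, inner_toLp_indicator hsL2 (𝓕.le _ _ hBk)] at this
    rw [hB B hBk]
    linarith
  · refine ae_le_of_forall_setIntegral_le_of_stronglyMeasurable (𝓕.le _)
      stronglyMeasurable_condExp (hSa _).stronglyMeasurable integrable_condExp (hSaint _)
      fun B hBk => ?_
    have := hg m _ ⟨B, 𝓕.le _ _ hBk, k, hBk, Or.inl rfl⟩
    rw [inner_toLp_indicator hsL2 (𝓕.le _ _ hBk)] at this
    rw [hB B hBk]
    linarith

end Existence

/-- For some `n` the tail integral is below `1` uniformly over `𝒟`; the rest of `|X|` is bounded by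
`n`. -/
lemma integrable_of_mem_strongL1 {Ω : Type*} [MeasurableSpace Ω] {P : Measure Ω}
    {𝒟 : Set (Measure Ω)} {X : Ω → ℝ} (hX : X ∈ StrongL1 P 𝒟) {Q : Measure Ω} (hQ𝒟 : Q ∈ 𝒟)
    (hQ : Q ∈ acProb P) : Integrable X Q := by
  have := hQ.1
  have hXm : AEMeasurable X Q := hX.1.mono_ac hQ.2
  obtain ⟨n, hn⟩ := (hX.2.eventually_lt_const one_pos).exists
  have htail : ∫⁻ ω in {ω | (n : ℝ) < |X ω|}, ENNReal.ofReal |X ω| ∂Q ≤ 1 :=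
    (le_iSup₂ (f := fun Q (_ : Q ∈ 𝒟) =>
      ∫⁻ ω in {ω | (n : ℝ) < |X ω|}, ENNReal.ofReal |X ω| ∂Q) Q hQ𝒟).trans hn.le
  refine ⟨hXm.aestronglyMeasurable, ?_⟩
  rw [hasFiniteIntegral_iff_norm]
  have hs : NullMeasurableSet {ω | (n : ℝ) < |X ω|} Q :=
    nullMeasurableSet_lt aemeasurable_const (measurable_abs.comp_aemeasurable hXm)
  simp only [Real.norm_eq_abs]
  rw [← setLIntegral_univ, ← Set.union_compl_self {ω | (n : ℝ) < |X ω|}]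
  refine (lintegral_union_le _ _ _).trans_lt (ENNReal.add_lt_top.2 ⟨htail.trans_lt ENNReal.one_lt_top, ?_⟩)
  calc ∫⁻ ω in {ω | (n : ℝ) < |X ω|}ᶜ, ENNReal.ofReal |X ω| ∂Q
      ≤ ∫⁻ _ in {ω | (n : ℝ) < |X ω|}ᶜ, ENNReal.ofReal n ∂Q := by
        refine lintegral_mono_ae ((ae_restrict_iff'₀ hs.compl).2 (ae_of_all _ fun ω hω => ?_))
        exact ENNReal.ofReal_le_ofReal (not_lt.1 hω)
    _ < ∞ := by
        rw [setLIntegral_const]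
        exact ENNReal.mul_lt_top ENNReal.ofReal_lt_top (measure_lt_top _ _)

/-! ### The three inclusions -/

section Main

variable {Ω I : Type*} [m : MeasurableSpace Ω] {T : ℝ} {𝓕 : Filtration (Set.Icc (0 : ℝ) T) m}
  {Sa Sb : I → Set.Icc (0 : ℝ) T → Ω → ℝ}

lemma cashFlow_le {h a b x : ℝ} (hb : b ≤ x) (ha : x ≤ a) : cashFlow h a b ≤ -(h * x) := by
  rcases lt_trichotomy h 0 with h0 | h0 | h0
  · simp only [cashFlow, h0, h0.not_gt, if_true, if_false]
    nlinarith
  · simp [cashFlow, h0]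
  · simp only [cashFlow, h0, h0.not_gt, if_true, if_false]
    nlinarith

lemma simpleTrades_subset_attainable : simpleTrades 𝓕 Sa Sb ⊆ attainable 𝓕 Sa Sb := by
  classical
  rintro X ⟨i, u, v, hu, hv, G, H, -, -, huv, hG, hH, ⟨_, hG0⟩, ⟨_, hH0⟩, rfl⟩
  have hmono : hu.measurableSpace ≤ hv.measurableSpace :=
    IsStoppingTime.measurableSpace_mono _ _ fun ω => WithTop.coe_le_coe.2 (huv ω)
  -- Each of `u` and `v` is used twice: netting `G` against `H` in a single trade would not pay the
  -- spread on both.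
  refine ⟨3, ![u, u, v, v], ?_, fun n j => if j = i then ![G, -H, -G, H] n else 0, {i}, ?_, ?_,
    ?_, ?_, ?_⟩
  · intro n
    fin_cases n
    exacts [hu, hu, hv, hv]
  · rw [Fin.monotone_iff_le_succ]
    intro n
    fin_cases n
    exacts [le_rfl, huv, le_rfl]
  · intro n j
    by_cases hj : j = i
    · simp only [hj, if_true]
      fin_cases n
      exacts [hG, hH.neg, (hG.mono hmono le_rfl).neg, hH.mono hmono le_rfl]
    · simp only [hj, if_false]
      exact measurable_const
  · intro n j hj
    simp only [Finset.mem_singleton] at hj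
    simp [hj]
  · intro j
    by_cases hj : j = i
    · simp [hj, Fin.sum_univ_four]
    · simp [hj]
  · ext ω
    have h1 : ∀ h a b : ℝ, 0 ≤ h → cashFlow h a b = -(h * a) := by
      intro h a b h0
      rcases h0.eq_or_lt with rfl | h0
      · simp [cashFlow]
      · simp [cashFlow, h0, h0.not_gt]
    have h2 : ∀ h a b : ℝ, 0 ≤ h → cashFlow (-h) a b = h * b := by
      intro h a b h0
      rcases h0.eq_or_lt with rfl | h0
      · simp [cashFlow]
      · simp [cashFlow, h0, h0.not_gt]
    simp only [Finset.sum_singleton, if_true]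
    refine Eq.trans ?_ (Fin.sum_univ_four _).symm
    change _ = cashFlow (G ω) (Sa i (u ω) ω) (Sb i (u ω) ω)
      + cashFlow (-H ω) (Sa i (u ω) ω) (Sb i (u ω) ω)
      + cashFlow (-G ω) (Sa i (v ω) ω) (Sb i (v ω) ω)
      + cashFlow (H ω) (Sa i (v ω) ω) (Sb i (v ω) ω)
    rw [h1 _ _ _ (hG0 ω).1, h2 _ _ _ (hH0 ω).1, h2 _ _ _ (hG0 ω).1, h1 _ _ _ (hH0 ω).1]
    ring

variable {P : Measure Ω} {𝒟 : Set (Measure Ω)} {Q : Measure Ω}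

lemma setIntegral_sub_nonpos_of_simpleTrade {B : Set Ω} (hB : MeasurableSet B) {f g : Ω → ℝ}
    (hf : Integrable f Q) (hg : Integrable g Q)
    (h : expect Q (fun ω => B.indicator 1 ω * (f ω - g ω)) ≤ 0) :
    ∫ ω in B, f ω ∂Q ≤ ∫ ω in B, g ω ∂Q := by
  have heq : (fun ω => B.indicator 1 ω * (f ω - g ω)) = B.indicator (f - g) := by
    ext ω
    by_cases hω : ω ∈ B <;> simp [hω]
  rw [heq, expect_eq_integral ((hf.sub hg).indicator hB), integral_indicator hB] at h
  have h' : ∫ ω in B, (f - g) ω ∂Q ≤ 0 := by exact_mod_cast h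
  rw [integral_sub' hf.integrableOn hg.integrableOn] at h'
  linarith

lemma mem_martingaleMeasures_of_simpleTrades (hT : 0 ≤ T) (h𝓕 : 𝓕.IsRightContinuous)
    (hSa : ∀ i, Adapted 𝓕 (Sa i)) (hSb : ∀ i, Adapted 𝓕 (Sb i))
    (hSac : ∀ i, IsCadlag (Sa i)) (hSbc : ∀ i, IsCadlag (Sb i))
    (hle : ∀ i, ∀ᵐ ω ∂P, ∀ t, Sb i t ω ≤ Sa i t ω)
    (hSaint : ∀ i t, Integrable (Sa i t) Q) (hSbint : ∀ i t, Integrable (Sb i t) Q)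
    (hQ : Q ∈ riskNeutral P (simpleTrades 𝓕 Sa Sb)) :
    Q ∈ martingaleMeasures P 𝓕 Sa Sb := by
  obtain ⟨hac, hQ⟩ := hQ
  have := hac.1
  refine ⟨hac, fun i => ?_⟩
  have hleQ : ∀ᵐ ω ∂Q, ∀ t, Sb i t ω ≤ Sa i t ω := hac.2.ae_le (hle i)
  have hone : ∀ (B : Set Ω) (ω : Ω),
      0 ≤ B.indicator (1 : Ω → ℝ) ω ∧ B.indicator (1 : Ω → ℝ) ω ≤ 1 := by
    intro B ω
    by_cases hω : ω ∈ B <;> simp [hω]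
  have hbid : ∀ t X, IsStoppedCondExp 𝓕 Q (Sb i) t X → X ≤ᵐ[Q] Sa i t := by
    rintro t X ⟨v, hv, hfin, htv, hint, heq⟩
    refine heq.symm.le.trans ?_
    refine ae_le_of_forall_setIntegral_le_of_stronglyMeasurable (𝓕.le t) stronglyMeasurable_condExp
      (hSa i t).stronglyMeasurable integrable_condExp (hSaint i t) fun B hB => ?_
    rw [setIntegral_condExp (𝓕.le t) hint hB]
    refine setIntegral_sub_nonpos_of_simpleTrade (𝓕.le t _ hB) hint (hSaint i t) (hQ _ ?_)
    refine ⟨i, fun _ => t, v, isStoppingTime_const 𝓕 t, hv, B.indicator 1, 0,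
      (Set.finite_singleton t).subset Set.range_const_subset, hfin, htv, ?_, measurable_const,
      ⟨1, hone B⟩, ⟨0, fun _ => by simp⟩, ?_⟩
    · rw [IsStoppingTime.measurableSpace_const]
      exact Measurable.indicator measurable_const hB
    · ext ω
      simp
  have hask : ∀ t X, IsStoppedCondExp 𝓕 Q (Sa i) t X → Sb i t ≤ᵐ[Q] X := by
    rintro t X ⟨v, hv, hfin, htv, hint, heq⟩
    refine EventuallyLE.trans ?_ heq.le
    refine ae_le_of_forall_setIntegral_le_of_stronglyMeasurable (𝓕.le t)
      (hSb i t).stronglyMeasurable stronglyMeasurable_condExp (hSbint i t) integrable_condExp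
      fun B hB => ?_
    rw [setIntegral_condExp (𝓕.le t) hint hB]
    refine setIntegral_sub_nonpos_of_simpleTrade (𝓕.le t _ hB) (hSbint i t) hint (hQ _ ?_)
    refine ⟨i, fun _ => t, v, isStoppingTime_const 𝓕 t, hv, 0, B.indicator 1,
      (Set.finite_singleton t).subset Set.range_const_subset, hfin, htv, measurable_const, ?_,
      ⟨0, fun _ => by simp⟩, ⟨1, hone B⟩, ?_⟩
    · rw [IsStoppingTime.measurableSpace_const]
      exact Measurable.indicator measurable_const hB
    · ext ω
      simp only [Pi.zero_apply]
      ring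
  obtain ⟨Z, hZ, hgrid⟩ := exists_martingale_between hT (hSa i) (hSb i) (hSaint i) (hSbint i)
    (fun t => hleQ.mono fun ω h => h t) hbid hask
  have hlow : ∀ t, Sb i t ≤ᵐ[Q] Q[Z|𝓕 t] := by
    intro t
    have := stopped_le_condExp hT h𝓕 (hSb i) (hSbc i) hZ (fun m k => (hgrid m k).1)
      (isStoppingTime_const 𝓕 t)
    rwa [IsStoppingTime.measurableSpace_const] at this
  have hupp : ∀ t, Q[Z|𝓕 t] ≤ᵐ[Q] Sa i t := by
    intro t
    have := condExp_le_stopped hT h𝓕 (hSa i) (hSac i) hZ (fun m k => (hgrid m k).2)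
      (isStoppingTime_const 𝓕 t)
    rwa [IsStoppingTime.measurableSpace_const] at this
  -- The bounds on `Q[Z|𝓕 t]` hold off a null set depending on `t`. Clipping to the bid-ask interval
  -- changes each `M t` only on a null set, and makes the bounds hold for all `t` at once.
  set M : Set.Icc (0 : ℝ) T → Ω → ℝ :=
    fun t ω => max (Sb i t ω) (min (Q[Z|𝓕 t] ω) (Sa i t ω)) with hM
  have hMZ : ∀ t, M t =ᵐ[Q] Q[Z|𝓕 t] := by
    intro t
    filter_upwards [hlow t, hupp t] with ω h1 h2
    simp only [hM]
    rw [min_eq_left h2, max_eq_right h1]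
  refine ⟨M, ⟨fun t => ?_, fun s t hst => ?_⟩, ?_⟩
  · exact ((hSb i t).max (stronglyMeasurable_condExp.measurable.min (hSa i t))).stronglyMeasurable
  · exact (condExp_congr_ae (hMZ t)).trans
      ((condExp_condExp_of_le (𝓕.mono hst) (𝓕.le t)).trans (hMZ s).symm)
  · filter_upwards [hleQ] with ω h t
    exact ⟨le_max_left _ _, max_le (h t) (min_le_right _ _)⟩

lemma expect_attainable_nonpos [IsFiniteMeasure Q] (hT : 0 ≤ T) (h𝓕 : 𝓕.IsRightContinuous)
    (hSa : ∀ i, Adapted 𝓕 (Sa i)) (hSb : ∀ i, Adapted 𝓕 (Sb i))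
    (hSac : ∀ i, IsCadlag (Sa i)) (hSbc : ∀ i, IsCadlag (Sb i)) {Z : I → Ω → ℝ}
    (hZ : ∀ i, Integrable (Z i) Q) (hlow : ∀ i t, Sb i t ≤ᵐ[Q] Q[Z i|𝓕 t])
    (hupp : ∀ i t, Q[Z i|𝓕 t] ≤ᵐ[Q] Sa i t) {X : Ω → ℝ} (hX : X ∈ attainable 𝓕 Sa Sb) :
    expect Q X ≤ 0 := by
  obtain ⟨N, u, hu, H, J, humono, hH, -, hHsum, rfl⟩ := hX
  -- Clamped indices extend the strategy to all of `ℕ`; the transform is evaluated only at time `N`.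
  set f : ℕ → Fin (N + 1) := fun n => ⟨min n N, Nat.lt_succ_of_le (min_le_right n N)⟩ with hf
  have hfval : ∀ n : Fin (N + 1), f n = n := fun n =>
    Fin.ext (min_eq_left (Nat.lt_succ_iff.1 n.2))
  have hfmono : Monotone f := fun k l hkl => Fin.le_def.2 (min_le_min_right N hkl)
  set G : ℕ → MeasurableSpace Ω := fun n => (hu (f n)).measurableSpace with hG
  have hGle : ∀ n, G n ≤ m := fun n => (hu (f n)).measurableSpace_le
  have hGmono : Monotone G := fun k l hkl =>
    IsStoppingTime.measurableSpace_mono _ _ fun ω =>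
      WithTop.coe_le_coe.2 (humono (hfmono hkl) ω)
  set U : ℕ → I → Ω → ℝ := fun n i => Q[Z i|G n] with hU
  set θ : ℕ → I → Ω → ℝ := fun n i => ∑ k ∈ Finset.range (n + 1), H (f k) i with hθ
  have hHm : ∀ {k n} i, k ≤ n → Measurable[G n] (H (f k) i) := fun i hkn =>
    (hH _ i).mono (hGmono hkn) le_rfl
  have hUm : ∀ {k n} i, k ≤ n → Measurable[G n] (U k i) := fun i hkn =>
    stronglyMeasurable_condExp.measurable.mono (hGmono hkn) le_rfl
  have hθm : ∀ n i, Measurable[G n] (θ n i) := by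
    intro n i
    have : θ n i = fun ω => ∑ k ∈ Finset.range (n + 1), H (f k) i ω := by
      ext ω
      simp [hθ]
    rw [this]
    exact Finset.measurable_fun_sum _ fun k hk =>
      hHm i (Nat.lt_succ_iff.1 (Finset.mem_range.1 hk))
  have hθN : ∀ i, θ N i = 0 := by
    intro i
    rw [← hHsum i]
    simp only [hθ]
    rw [Finset.sum_range]
    simp only [hfval]
  -- Value of the current positions at the prices `U`, less the cost of all purchases at these
  -- prices. It starts at `0` and has increments `θ n (U (n + 1) - U n)`; at `N` all positions are
  -- closed and only the cash remains, which dominates the P&L.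
  set L : ℕ → Ω → ℝ := fun n ω => ∑ i ∈ J, (θ n i ω * U n i ω
    - ∑ k ∈ Finset.range (n + 1), H (f k) i ω * U k i ω) with hL
  have hLm : ∀ n, Measurable[G n] (L n) := fun n =>
    Finset.measurable_fun_sum _ fun i _ => ((hθm n i).mul (hUm i le_rfl)).sub
      (Finset.measurable_fun_sum _ fun k hk =>
        have hkn := Nat.lt_succ_iff.1 (Finset.mem_range.1 hk)
        (hHm i hkn).mul (hUm i hkn))
  have hD0 : ∀ n i, Q[U (n + 1) i - U n i|G n] =ᵐ[Q] 0 := by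
    intro n i
    have h1 := condExp_sub (μ := Q) (f := U (n + 1) i) (g := U n i) integrable_condExp
      integrable_condExp (G n)
    have h2 : Q[U (n + 1) i|G n] =ᵐ[Q] U n i :=
      condExp_condExp_of_le (hGmono (Nat.le_succ n)) (hGle (n + 1))
    have h3 : Q[U n i|G n] = U n i :=
      condExp_of_stronglyMeasurable (hGle n) stronglyMeasurable_condExp integrable_condExp
    filter_upwards [h1, h2] with ω h1 h2
    rw [h1, Pi.sub_apply, h2, h3, sub_self, Pi.zero_apply]
  refine expect_nonpos_of_ae_le (Y := L N) ?_ fun hfin =>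
    lintegral_transform_le G hGle J L θ (fun n i => U (n + 1) i - U n i) hLm hθm
      (fun n i => integrable_condExp.sub integrable_condExp) hD0 ?_ ?_ N hfin
  · have hbound : ∀ᵐ ω ∂Q, ∀ i ∈ J, ∀ k : ℕ,
        Sb i (u (f k) ω) ω ≤ U k i ω ∧ U k i ω ≤ Sa i (u (f k) ω) ω := by
      refine (ae_ball_iff J.countable_toSet).2 fun i _ => ae_all_iff.2 fun k => ?_
      exact (stopped_le_condExp hT h𝓕 (hSb i) (hSbc i) (hZ i) (fun _ _ => hlow i _)
        (hu (f k))).and (condExp_le_stopped hT h𝓕 (hSa i) (hSac i) (hZ i) (fun _ _ => hupp i _)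
        (hu (f k)))
    filter_upwards [hbound] with ω hω
    simp only [hL, hθN, Pi.zero_apply, zero_mul, zero_sub]
    rw [Finset.sum_comm]
    refine Finset.sum_le_sum fun i hi => ?_
    rw [← Finset.sum_neg_distrib, Finset.sum_range]
    refine Finset.sum_le_sum fun n _ => ?_
    have h := hω i hi n
    rw [hfval] at h ⊢
    exact cashFlow_le h.1 h.2
  · ext ω
    simp [hL, hθ]
  · intro n ω
    simp only [hL, hθ]
    rw [← Finset.sum_add_distrib]
    refine Finset.sum_congr rfl fun i _ => ?_
    rw [Finset.sum_range_succ _ (n + 1), Finset.sum_range_succ _ (n + 1)]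
    simp only [Pi.add_apply, Pi.sub_apply]
    ring

lemma martingaleMeasures_subset_riskNeutral (hT : 0 ≤ T) (h𝓕 : 𝓕.IsRightContinuous)
    (hSa : ∀ i, Adapted 𝓕 (Sa i)) (hSb : ∀ i, Adapted 𝓕 (Sb i))
    (hSac : ∀ i, IsCadlag (Sa i)) (hSbc : ∀ i, IsCadlag (Sb i)) :
    martingaleMeasures P 𝓕 Sa Sb ⊆ riskNeutral P (attainable 𝓕 Sa Sb) := by
  rintro Q ⟨hac, hM⟩
  have := hac.1
  choose M hMmart hM using hM
  have hcond : ∀ i t, Q[M i ⟨T, hT, le_rfl⟩|𝓕 t] =ᵐ[Q] M i t := fun i t =>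
    (hMmart i).2 t _ t.2.2
  refine ⟨hac, fun X hX => expect_attainable_nonpos hT h𝓕 hSa hSb hSac hSbc
    (Z := fun i => M i ⟨T, hT, le_rfl⟩) (fun i => (hMmart i).integrable _) (fun i t => ?_)
    (fun i t => ?_) hX⟩
  · filter_upwards [hcond i t, hM i] with ω h1 h2
    rw [h1]
    exact (h2 t).1
  · filter_upwards [hcond i t, hM i] with ω h1 h2
    rw [h1]
    exact (h2 t).2

end Main

end BidAsk

theorem lemma3p12 {Ω I : Type*} [m : MeasurableSpace Ω] (P : Measure Ω) [IsProbabilityMeasure P]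
    (T : ℝ) (hT : 0 ≤ T) (𝓕 : Filtration (Set.Icc (0 : ℝ) T) m)
    (h𝓕_trivial : ∀ B, MeasurableSet[𝓕 ⟨0, le_refl 0, hT⟩] B → P B = 0 ∨ P B = 1)
    (h𝓕_right : 𝓕.IsRightContinuous)
    (𝒟 : Set (Measure Ω)) (h𝒟 : BidAsk.IsConvexWeaklyCompact P 𝒟)
    (Sa Sb : I → Set.Icc (0 : ℝ) T → Ω → ℝ)
    (hSa_adapted : ∀ i, Adapted 𝓕 (Sa i)) (hSb_adapted : ∀ i, Adapted 𝓕 (Sb i))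
    (hSa_cadlag : ∀ i, BidAsk.IsCadlag (Sa i)) (hSb_cadlag : ∀ i, BidAsk.IsCadlag (Sb i))
    (hS_le : ∀ i, ∀ᵐ ω ∂P, ∀ t, Sb i t ω ≤ Sa i t ω)
    (hSa_L1 : ∀ i t, Sa i t ∈ BidAsk.StrongL1 P 𝒟)
    (hSb_L1 : ∀ i t, Sb i t ∈ BidAsk.StrongL1 P 𝒟) :
    𝒟 ∩ BidAsk.riskNeutral P (BidAsk.attainable 𝓕 Sa Sb) =
        𝒟 ∩ BidAsk.riskNeutral P (BidAsk.simpleTrades 𝓕 Sa Sb) ∧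
      𝒟 ∩ BidAsk.riskNeutral P (BidAsk.simpleTrades 𝓕 Sa Sb) =
        𝒟 ∩ BidAsk.martingaleMeasures P 𝓕 Sa Sb := by
  have h1 : 𝒟 ∩ BidAsk.riskNeutral P (BidAsk.attainable 𝓕 Sa Sb) ⊆
      𝒟 ∩ BidAsk.riskNeutral P (BidAsk.simpleTrades 𝓕 Sa Sb) := fun Q hQ =>
    ⟨hQ.1, hQ.2.1, fun X hX => hQ.2.2 X (BidAsk.simpleTrades_subset_attainable hX)⟩
  have h2 : 𝒟 ∩ BidAsk.riskNeutral P (BidAsk.simpleTrades 𝓕 Sa Sb) ⊆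
      𝒟 ∩ BidAsk.martingaleMeasures P 𝓕 Sa Sb := fun Q hQ =>
    ⟨hQ.1, BidAsk.mem_martingaleMeasures_of_simpleTrades hT h𝓕_right hSa_adapted hSb_adapted
      hSa_cadlag hSb_cadlag hS_le
      (fun i t => BidAsk.integrable_of_mem_strongL1 (hSa_L1 i t) hQ.1 (h𝒟.subset hQ.1))
      (fun i t => BidAsk.integrable_of_mem_strongL1 (hSb_L1 i t) hQ.1 (h𝒟.subset hQ.1)) hQ.2⟩
  have h3 : 𝒟 ∩ BidAsk.martingaleMeasures P 𝓕 Sa Sb ⊆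
      𝒟 ∩ BidAsk.riskNeutral P (BidAsk.attainable 𝓕 Sa Sb) :=
    Set.inter_subset_inter_right _ (BidAsk.martingaleMeasures_subset_riskNeutral hT h𝓕_right
      hSa_adapted hSb_adapted hSa_cadlag hSb_cadlag)
  exact ⟨h1.antisymm (h2.trans h3), h2.antisymm (h3.trans h1)⟩
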